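/- For $p,q\in\mathbb R$ put $F(a,b)=4a^2(b-p)(b+q)-(b^2+pq)^2$. The Hitchin flow is the system $$\dot x_1=\frac{\partial_aF(y_1,y_2)}{4\sqrt{F(y_1,y_2)}},\quad \dot x_2=\frac{\partial_bF(y_1,y_2)}{2\sqrt{F(y_1,y_2)}},\quad \dot y_1=\frac{x_1x_2}{\sqrt{x_1^2x_2}},\quad \dot y_2=\frac{x_1^2}{\sqrt{x_1^2x_2}}$$ on the domain $F(y_1,y_2)>0$, $x_1^2x_2>0$. For reals $r_0>0$, $\bar a>\bar b$ with $64r_0(2\bar a+\bar b)=1$, a complete solution of the $\mathbb B_7$-family with parameters $(r_0,\bar a,\bar b)$ is a pair $(a,b)$ of real functions on $[0,\infty)$, smooth up to $t=0$, such that $x_1=\dot a\dot b$, $x_2=\dot a^2$, $y_1=a$, $y_2=b$ solve the Hitchin flow for all $t>0$ with $p=-q=r_0^3$, and, as $t\to0^+$, $$a(t)=r_0^3+\tfrac14r_0t^2+\bar at^4+O(t^6),\qquad b(t)=r_0^3+\tfrac14r_0t^2+\bar bt^4+O(t^6).$$ Its metric coefficients are, for $t>0$, $$A_1=A_2=\sqrt{\frac{(b-p)(2a-b-p)}{\dot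 a\dot b}},\quad A_3=\frac{b-p}{\dot a},\quad B_1=B_2=\sqrt{\frac{(b-p)(2a+b+p)}{\dot a\dot b}},\quad B_3=\frac{2\dot a\dot b}{b-p}.$$ For $m>0$ let $\eta:(0,\infty)\to(m^{-2},\infty)$ be the inverse of the decreasing bijection $x\mapsto\int_x^\infty s^{1/2}(s-m^{-2})^{-2}\,ds$ from $(m^{-2},\infty)$ to $(0,\infty)$ (that is, $dt=-\eta^{1/2}(\eta-m^{-2})^{-2}d\eta$ with $\eta\to\infty$ as $t\to0^+$), and let $$f_1=f_2=\eta^{1/2}(\eta-m^{-2})^{-1},\qquad f_3=\eta^{-1/2}$$ be the coefficients of the Taub-NUT metric. **Proposition.** Fix $m>0$. Consider complete solutions of the $\mathbb B_7$-family whose parameters satisfy $m^2=\bigl(24\,r_0^3(2\bar a-\bar b)\bigr)^{-1}$, and for $\lambda>0$ put $A_i^\lambda(t)=\lambda^{-2}A_i(\lambda^2t)$, $B_i^\lambda(t)=\lambda^{-1}B_i(\lambda^2t)$. Take $\lambda=r_0$. Then, along any family (or sequence) of such solutions with $r_0\to0$, for $i=1,2,3$ and every $T>0$, $$B_i^\lambda\to2,\qquad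 A_i^\lambda\to f_i\qquad\text{uniformly on }(0,T]$$ (equivalently, uniformly on $[0,T]$ once all functions are extended continuously to $t=0$). -/

import Mathlib

open Set Filter Topology MeasureTheory Asymptotics
open scoped ContDiff

namespace B7

/-- The function `F(a,b) = 4a²(b-p)(b+q) - (b²+pq)²`. -/
def hitchinF (p q a b : ℝ) : ℝ :=
  4 * a ^ 2 * (b - p) * (b + q) - (b ^ 2 + p * q) ^ 2

/-- `(x₁,x₂,y₁,y₂)` solves the Hitchin flow on `(0,∞)`, inside the domain
`F(y₁,y₂) > 0`, `x₁² x₂ > 0` where its right-hand sides are defined. -/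
structure IsHitchinFlow (p q : ℝ) (x₁ x₂ y₁ y₂ : ℝ → ℝ) : Prop where
  F_pos : ∀ t, 0 < t → 0 < hitchinF p q (y₁ t) (y₂ t)
  x_pos : ∀ t, 0 < t → 0 < x₁ t ^ 2 * x₂ t
  ode_x₁ : ∀ t, 0 < t → HasDerivAt x₁
    (deriv (fun u => hitchinF p q u (y₂ t)) (y₁ t)
      / (4 * √(hitchinF p q (y₁ t) (y₂ t)))) t
  ode_x₂ : ∀ t, 0 < t → HasDerivAt x₂
    (deriv (fun u => hitchinF p q (y₁ t) u) (y₂ t)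
      / (2 * √(hitchinF p q (y₁ t) (y₂ t)))) t
  ode_y₁ : ∀ t, 0 < t → HasDerivAt y₁ (x₁ t * x₂ t / √(x₁ t ^ 2 * x₂ t)) t
  ode_y₂ : ∀ t, 0 < t → HasDerivAt y₂ (x₁ t ^ 2 / √(x₁ t ^ 2 * x₂ t)) t

/-- `(a,b)` is the complete solution in the `𝔹₇`-family with parameters `r₀, ā, b̄`:
it is defined for all `t > 0`, extends smoothly to `t = 0`, solves the Hitchin flow with
`p = -q = r₀³`, `x₁ = a' b'`, `x₂ = a'²`, `y₁ = a`, `y₂ = b`, and has the prescribed expansion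
at the singular orbit `t = 0`. -/
structure IsB7Solution (r₀ abar bbar : ℝ) (a b : ℝ → ℝ) : Prop where
  r₀_pos : 0 < r₀
  constraint : 64 * r₀ * (2 * abar + bbar) = 1
  bbar_lt_abar : bbar < abar
  smooth_a : ContDiffOn ℝ ∞ a (Ici 0)
  smooth_b : ContDiffOn ℝ ∞ b (Ici 0)
  flow : IsHitchinFlow (r₀ ^ 3) (-r₀ ^ 3)
    (fun t => deriv a t * deriv b t) (fun t => deriv a t ^ 2) a b
  expansion_a : (fun t => a t - (r₀ ^ 3 + 1 / 4 * r₀ * t ^ 2 + abar * t ^ 4))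
    =O[𝓝[>] 0] fun t => t ^ 6
  expansion_b : (fun t => b t - (r₀ ^ 3 + 1 / 4 * r₀ * t ^ 2 + bbar * t ^ 4))
    =O[𝓝[>] 0] fun t => t ^ 6

/-- The metric coefficients `A₁ = A₂, A₃` (indices `0, 1, 2` here), for `t > 0`. -/
noncomputable def metricA (p : ℝ) (a b : ℝ → ℝ) : Fin 3 → ℝ → ℝ :=
  let A₁ : ℝ → ℝ := fun t =>
    √((b t - p) * (2 * a t - b t - p) / (deriv a t * deriv b t))
  let A₃ : ℝ → ℝ := fun t => (b t - p) / deriv a t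
  ![A₁, A₁, A₃]

/-- The metric coefficients `B₁ = B₂, B₃` (indices `0, 1, 2` here), for `t > 0`. -/
noncomputable def metricB (p : ℝ) (a b : ℝ → ℝ) : Fin 3 → ℝ → ℝ :=
  let B₁ : ℝ → ℝ := fun t =>
    √((b t - p) * (2 * a t + b t + p) / (deriv a t * deriv b t))
  let B₃ : ℝ → ℝ := fun t => 2 * deriv a t * deriv b t / (b t - p)
  ![B₁, B₁, B₃]

/-- `A ↦ A^l`, `A^l(t) = l⁻² A(l² t)`. -/
noncomputable def rescaleA (l : ℝ) (A : ℝ → ℝ) : ℝ → ℝ := fun t => (l ^ 2)⁻¹ * A (l ^ 2 * t)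

/-- `B ↦ B^l`, `B^l(t) = l⁻¹ B(l² t)`. -/
noncomputable def rescaleB (l : ℝ) (B : ℝ → ℝ) : ℝ → ℝ := fun t => l⁻¹ * B (l ^ 2 * t)

/-- Arc length `t` on Taub-NUT as a function of `η ∈ (m⁻², ∞)`: the integral from `∞` of
`dt = -η^{1/2} (η - m⁻²)⁻² dη`. -/
noncomputable def taubNUTTime (m x : ℝ) : ℝ :=
  ∫ s in Ioi x, √s / (s - 1 / m ^ 2) ^ 2

/-- The variable `η` as a function of arc length `t > 0`: the inverse of the
bijection `taubNUTTime m : (m⁻², ∞) → (0, ∞)` (see `taubNUTTime_bijOn`). -/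
noncomputable def taubNUTEta (m : ℝ) : ℝ → ℝ :=
  Function.invFunOn (taubNUTTime m) (Ioi (1 / m ^ 2))

/-- The Taub-NUT metric coefficients `f₁ = f₂, f₃` (indices `0, 1, 2` here), for `t > 0`. -/
noncomputable def taubNUT (m : ℝ) : Fin 3 → ℝ → ℝ :=
  let f₁ : ℝ → ℝ := fun t => √(taubNUTEta m t) * (taubNUTEta m t - 1 / m ^ 2)⁻¹
  let f₃ : ℝ → ℝ := fun t => (√(taubNUTEta m t))⁻¹
  ![f₁, f₁, f₃]

/-! Closed form of the arc length, and the bijectivity used to define `η`. -/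

/-- An antiderivative of the integrand of `taubNUTTime` vanishing at infinity. -/
noncomputable def taubNUTPrim (m x : ℝ) : ℝ :=
  -(√x / (x - 1 / m ^ 2)) +
    m / 2 * (Real.log (1 - 1 / (m * √x)) - Real.log (1 + 1 / (m * √x)))

theorem one_lt_mul_sqrt {m x : ℝ} (hm : 0 < m) (hx : 1 / m ^ 2 < x) : 1 < m * √x := by
  have h : √(1 / m ^ 2) < √x := Real.sqrt_lt_sqrt (by positivity) hx
  have h2 : √(1 / m ^ 2) = 1 / m := by
    rw [show 1 / m ^ 2 = (1 / m) ^ 2 by ring]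
    exact Real.sqrt_sq (by positivity)
  rw [h2, div_lt_iff₀ hm] at h
  linarith

theorem hasDerivAt_taubNUTPrim {m x : ℝ} (hm : 0 < m) (hx : 1 / m ^ 2 < x) :
    HasDerivAt (taubNUTPrim m) (√x / (x - 1 / m ^ 2) ^ 2) x := by
  have hx0 : 0 < x := lt_trans (by positivity) hx
  have h1 := one_lt_mul_sqrt hm hx
  have hs : 0 < √x := Real.sqrt_pos.2 hx0
  have hsd : HasDerivAt (fun y => √y) (1 / (2 * √x)) x := Real.hasDerivAt_sqrt hx0.ne'
  have hc : HasDerivAt (fun y => 1 / (m * √y)) (-(m * (1 / (2 * √x))) / (m * √x) ^ 2) x := by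
    simp only [one_div (m * _)]
    exact (hsd.const_mul m).inv (by positivity)
  have hlt : 1 / (m * √x) < 1 := by rw [div_lt_one (by linarith)]; exact h1
  have hpos : 0 < 1 / (m * √x) := by positivity
  have hA := (hsd.div ((hasDerivAt_id x).sub_const (1 / m ^ 2)) (by simp only [id]; linarith)).neg
  have hB := ((hc.const_sub 1).log (by linarith)).sub ((hc.const_add 1).log (by linarith))
  have h := hA.add (hB.const_mul (m / 2))
  refine h.congr_deriv ?_
  have hxs : x = √x ^ 2 := (Real.sq_sqrt hx0.le).symm
  set s := √x with hsdef
  rw [hxs]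
  have e1 : m * s - 1 ≠ 0 := by linarith
  have e2 : m * s + 1 ≠ 0 := by linarith
  have e3 : s ^ 2 - 1 / m ^ 2 = (m * s - 1) * (m * s + 1) / m ^ 2 := by field_simp; ring
  have e4 : 1 - 1 / (m * s) = (m * s - 1) / (m * s) := by field_simp
  have e5 : 1 + 1 / (m * s) = (m * s + 1) / (m * s) := by field_simp
  simp only [id]
  rw [e3, e4, e5]
  obtain ⟨u, hu⟩ : ∃ u, u = m * s - 1 := ⟨_, rfl⟩
  obtain ⟨v, hv⟩ : ∃ v, v = m * s + 1 := ⟨_, rfl⟩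
  rw [← hu] at e1
  rw [← hv] at e2
  rw [← hu, ← hv]
  field_simp
  subst hu hv
  ring

theorem tendsto_taubNUTPrim_atTop {m : ℝ} (hm : 0 < m) :
    Tendsto (taubNUTPrim m) atTop (𝓝 0) := by
  have hs : Tendsto (fun x : ℝ => √x) atTop atTop := Real.tendsto_sqrt_atTop
  have hi : Tendsto (fun x : ℝ => 1 / (m * √x)) atTop (𝓝 0) := by
    simp only [one_div]
    exact (hs.const_mul_atTop hm).inv_tendsto_atTop
  have hq : Tendsto (fun x : ℝ => √x / (x - 1 / m ^ 2)) atTop (𝓝 0) := by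
    have hd : Tendsto (fun x : ℝ => √x + -(1 / m ^ 2)) atTop atTop :=
      tendsto_atTop_add_const_right _ _ hs
    have hj : Tendsto (fun x : ℝ => (√x - (1 / m ^ 2) * (√x)⁻¹)⁻¹) atTop (𝓝 0) := by
      apply Tendsto.inv_tendsto_atTop
      refine tendsto_atTop_mono' _ ?_ hd
      filter_upwards [hs.eventually_ge_atTop 1] with x hx
      have : (√x)⁻¹ ≤ 1 := inv_le_one_of_one_le₀ hx
      have h0 : 0 < 1 / m ^ 2 := by positivity
      nlinarith
    refine hj.congr' ?_
    filter_upwards [eventually_gt_atTop (1 / m ^ 2)] with x hx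
    have hx0 : 0 < x := lt_trans (by positivity) hx
    have hsx : 0 < √x := Real.sqrt_pos.2 hx0
    have e : √x - 1 / m ^ 2 * (√x)⁻¹ = (x - 1 / m ^ 2) / √x := by
      rw [sub_div, Real.div_sqrt, div_eq_mul_inv (1 / m ^ 2)]
    rw [e, inv_div]
  have hl1 : Tendsto (fun x : ℝ => Real.log (1 - 1 / (m * √x))) atTop (𝓝 0) := by
    simpa using (hi.const_sub 1).log (by norm_num)
  have hl2 : Tendsto (fun x : ℝ => Real.log (1 + 1 / (m * √x))) atTop (𝓝 0) := by
    simpa using (hi.const_add 1).log (by norm_num)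
  have h := hq.neg.add ((hl1.sub hl2).const_mul (m / 2))
  simp only [sub_zero, mul_zero, neg_zero, add_zero] at h
  exact h

theorem taubNUTTime_eq {m x : ℝ} (hm : 0 < m) (hx : 1 / m ^ 2 < x) :
    taubNUTTime m x = -taubNUTPrim m x := by
  have h := integral_Ioi_of_hasDerivAt_of_nonneg' (g := taubNUTPrim m)
    (g' := fun s => √s / (s - 1 / m ^ 2) ^ 2) (a := x) (l := 0)
    (fun y hy => hasDerivAt_taubNUTPrim hm (lt_of_lt_of_le hx hy))
    (fun y _ => by positivity) (tendsto_taubNUTPrim_atTop hm)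
  rw [taubNUTTime, h, zero_sub]

theorem taubNUTPrim_strictMonoOn {m : ℝ} (hm : 0 < m) :
    StrictMonoOn (taubNUTPrim m) (Ioi (1 / m ^ 2)) := by
  refine strictMonoOn_of_deriv_pos (convex_Ioi _)
    (fun x hx => (hasDerivAt_taubNUTPrim hm hx).continuousAt.continuousWithinAt) ?_
  intro x hx
  rw [interior_Ioi] at hx
  rw [(hasDerivAt_taubNUTPrim hm hx).deriv]
  have hx0 : 0 < x := lt_trans (by positivity) hx
  have : 0 < x - 1 / m ^ 2 := sub_pos.2 hx
  have := Real.sqrt_pos.2 hx0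
  positivity

theorem taubNUTPrim_le {m x : ℝ} (hm : 0 < m) (hx : 1 / m ^ 2 < x) :
    taubNUTPrim m x ≤ -(√x / (x - 1 / m ^ 2)) := by
  have h1 := one_lt_mul_sqrt hm hx
  have hpos : 0 < 1 / (m * √x) := by positivity
  have hlt : 1 / (m * √x) < 1 := by rw [div_lt_one (by linarith)]; exact h1
  have := Real.log_le_log (x := 1 - 1 / (m * √x)) (y := 1 + 1 / (m * √x))
    (by linarith) (by linarith)
  rw [taubNUTPrim]
  nlinarith

theorem taubNUTTime_bijOn {m : ℝ} (hm : 0 < m) :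
    BijOn (taubNUTTime m) (Ioi (1 / m ^ 2)) (Ioi 0) := by
  have hneg : ∀ x, 1 / m ^ 2 < x → taubNUTPrim m x < 0 := by
    intro x hx
    refine lt_of_le_of_lt (taubNUTPrim_le hm hx) (neg_neg_of_pos ?_)
    exact div_pos (Real.sqrt_pos.2 (lt_trans (by positivity) hx)) (sub_pos.2 hx)
  refine ⟨fun x hx => ?_, fun x hx y hy h => ?_, fun t ht => ?_⟩
  · rw [mem_Ioi, taubNUTTime_eq hm hx]
    linarith [hneg x hx]
  · rw [taubNUTTime_eq hm hx, taubNUTTime_eq hm hy, neg_inj] at h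
    exact (taubNUTPrim_strictMonoOn hm).injOn hx hy h
  · have ht0 : (0 : ℝ) < t := ht
    obtain ⟨y, hy, hyk⟩ := (((tendsto_taubNUTPrim_atTop hm).eventually
      (lt_mem_nhds (show -t < 0 by linarith))).and
      (eventually_gt_atTop (1 / m ^ 2))).exists
    have hk : 0 < 1 / m ^ 2 := by positivity
    have hm1 : 0 < 1 / m := by positivity
    -- a point close to `m⁻²`, where the time is at least `t`
    set x := 1 / m ^ 2 + 1 / m / t with hxdef
    have hx : 1 / m ^ 2 < x := by
      have : 0 < 1 / m / t := by positivity
      linarith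
    have hxt : taubNUTPrim m x ≤ -t := by
      refine (taubNUTPrim_le hm hx).trans (neg_le_neg ?_)
      have h1 := one_lt_mul_sqrt hm hx
      have e : x - 1 / m ^ 2 = 1 / m / t := by rw [hxdef]; ring
      rw [e, le_div_iff₀ (by positivity)]
      have e2 : t * (1 / m / t) = 1 / m := by field_simp
      rw [e2, div_le_iff₀ hm]
      linarith
    have hsub : uIcc x y ⊆ Ioi (1 / m ^ 2) := by
      intro z hz
      exact lt_of_lt_of_le (lt_min hx hyk) hz.1
    have hcont : ContinuousOn (taubNUTPrim m) (uIcc x y) := fun z hz =>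
      (hasDerivAt_taubNUTPrim hm (hsub hz)).continuousAt.continuousWithinAt
    have hmem : -t ∈ uIcc (taubNUTPrim m x) (taubNUTPrim m y) :=
      mem_uIcc.2 (Or.inl ⟨hxt, hy.le⟩)
    obtain ⟨z, hz, hzt⟩ := intermediate_value_uIcc hcont hmem
    exact ⟨z, hsub hz, by rw [taubNUTTime_eq hm (hsub hz), hzt, neg_neg]⟩

/-- `η(t)` lies in `(m⁻², ∞)` and has arc length `t`, for `t > 0`. -/
theorem taubNUTEta_spec {m t : ℝ} (hm : 0 < m) (ht : 0 < t) :
    1 / m ^ 2 < taubNUTEta m t ∧ taubNUTTime m (taubNUTEta m t) = t :=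
  ⟨Function.invFunOn_mem ((taubNUTTime_bijOn hm).surjOn ht),
    Function.invFunOn_eq ((taubNUTTime_bijOn hm).surjOn ht)⟩

end B7

namespace B7

/-! ### One-variable calculus on `(0, ∞)` -/

/-! After rescaling by `λ = r₀`, the metric coefficients solve a first-order system depending on the
parameters only through `e = r₀²` (`IsB7Solution.isScaledFlow`). At `e = 0` it admits `B₁ = B₃ = 2`,
and then `κ = (A₁ - A₃) / (A₁ A₃²)` is a first integral. Taub-NUT is the case `κ = m⁻²`: there `f₃ =
(1 - m⁻² f₃²) f₁`, so `f₃` solves the scalar equation `f₃' = (1 - m⁻² f₃²)² / 2`.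

For `e > 0` the expansion at the singular orbit and the mass condition give `κ → m⁻² - e/8` as `t →
0`. A bootstrap (`half_lt_kappa`) shows that `κ` increases and that `A₃ < A₁` and `B₁ ≤ B₃` for all
time. While `e T² ≤ 1`, a second bootstrap (`half_lt_ratio`) keeps `B₁ / B₃ > 1/2`. This yields `A₁
≤ 5t/4`, `1 - B₁/B₃ = O(e)` and `κ' ≤ e T κ`, so `κ` stays within `O(e)` of `m⁻²` (`le_kappa`,
`kappa_le`). The conserved quantity in `conserved` turns the ratio bound into `B₁, B₃ = 2 + O(e)`.

Since `A₃ / A₁ = 1 - κ A₃²`, the equation for `A₃` is an `O(e)` perturbation of that for `f₃`, and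
Gronwall gives `A₃ - f₃ = O(e)`. The bound for `A₁ - f₁` follows algebraically, because `1 - m⁻²
f₃²` is bounded below on `(0, T]` (`exists_bound_taubNUT`). All convergence is thus at rate
`O(r₀²)`. -/

theorem taylorWithinEval_eq_zero_of_isLittleO {g : ℝ → ℝ} (hg : ContDiffOn ℝ ∞ g (Ici 0)) (n : ℕ)
    (ho : g =o[𝓝[>] 0] fun t => t ^ n) : taylorWithinEval g n (Ici 0) 0 = 0 := by
  have key : ∀ k : ℕ, (fun t => g t - taylorWithinEval g k (Ici 0) 0 t) =o[𝓝[>] 0]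
      fun t => t ^ k := by
    intro k
    have h := taylor_isLittleO (n := k) (convex_Ici 0) (self_mem_Ici)
      (hg.of_le (by exact_mod_cast le_top))
    simp only [sub_zero] at h
    exact h.mono (nhdsWithin_mono _ Ioi_subset_Ici_self)
  have coeff : ∀ (k : ℕ) (c : ℝ), (fun t : ℝ => t ^ k * c) =o[𝓝[>] 0] (fun t => t ^ k) →
      c = 0 := by
    intro k c h
    have h1 := h.tendsto_div_nhds_zero
    have h2 : Tendsto (fun t : ℝ => t ^ k * c / t ^ k) (𝓝[>] 0) (𝓝 c) := by
      refine tendsto_const_nhds.congr' ?_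
      filter_upwards [self_mem_nhdsWithin] with t ht
      have : t ≠ 0 := ne_of_gt ht
      field_simp
    exact tendsto_nhds_unique h2 h1
  induction n with
  | zero =>
    funext t
    have h := ho.sub (key 0)
    simp only [taylor_within_zero_eval, sub_sub_cancel] at h ⊢
    exact coeff 0 _ (by simpa using h)
  | succ n ih =>
    have hn := ih (ho.trans_isBigO (by
      refine IsBigO.of_bound 1 ?_
      filter_upwards [Ioo_mem_nhdsGT (zero_lt_one' ℝ)] with t ht
      rw [one_mul, Real.norm_of_nonneg (pow_nonneg ht.1.le _),
        Real.norm_of_nonneg (pow_nonneg ht.1.le _)]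
      exact pow_le_pow_of_le_one ht.1.le ht.2.le (Nat.le_succ n)))
    -- By induction the lower-order coefficients vanish, so only the top monomial remains.
    have e : ∀ t, taylorWithinEval g (n + 1) (Ici 0) 0 t =
        t ^ (n + 1) * ((((n : ℝ) + 1) * (n.factorial : ℝ))⁻¹ *
          iteratedDerivWithin (n + 1) g (Ici 0) 0) := by
      intro t
      rw [taylorWithinEval_succ, hn, sub_zero, smul_eq_mul, Pi.zero_apply]
      ring
    have h := ho.sub (key (n + 1))
    simp only [sub_sub_cancel, e] at h
    funext t
    rw [e, coeff _ _ h, mul_zero, Pi.zero_apply]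

/-- The derivative of a function that is smooth up to `0` and vanishes there to high order. -/
theorem deriv_isLittleO_of_isLittleO {g : ℝ → ℝ} (hg : ContDiffOn ℝ ∞ g (Ici 0)) (n : ℕ)
    (ho : g =o[𝓝[>] 0] fun t => t ^ (n + 1)) : deriv g =o[𝓝[>] 0] fun t => t ^ n := by
  have h0 := taylorWithinEval_eq_zero_of_isLittleO hg (n + 1) ho
  have h1 : taylorWithinEval (derivWithin g (Ici 0)) n (Ici 0) 0 = 0 := by
    funext t
    have h := hasDerivAt_taylorWithinEval_succ (x₀ := 0) (x := t) (s := Ici 0) g n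
    rw [h0] at h
    exact h.unique (hasDerivAt_const t (0 : ℝ))
  have h2 := taylor_isLittleO (f := derivWithin g (Ici 0)) (n := n) (convex_Ici (0 : ℝ))
    self_mem_Ici ((hg.derivWithin (m := ∞) (uniqueDiffOn_Ici 0) (by simp)).of_le
      (by exact_mod_cast le_top))
  simp only [h1, Pi.zero_apply, sub_zero] at h2
  refine (h2.mono (nhdsWithin_mono _ Ioi_subset_Ici_self)).congr' ?_ EventuallyEq.rfl
  filter_upwards [self_mem_nhdsWithin] with t ht
  exact derivWithin_of_mem_nhds (Ici_mem_nhds ht)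

theorem monotoneOn_Ioc_of_hasDerivAt_nonneg {f f' : ℝ → ℝ} {T : ℝ}
    (hd : ∀ s, 0 < s → HasDerivAt f (f' s) s) (hn : ∀ s ∈ Ioo 0 T, 0 ≤ f' s) :
    MonotoneOn f (Ioc 0 T) := by
  refine monotoneOn_of_deriv_nonneg (convex_Ioc 0 T)
    (fun s hs => (hd s hs.1).continuousAt.continuousWithinAt)
    (fun s hs => ?_) (fun s hs => ?_)
  · rw [interior_Ioc] at hs
    exact (hd s hs.1).differentiableAt.differentiableWithinAt
  · rw [interior_Ioc] at hs
    rw [(hd s hs.1).deriv]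
    exact hn s hs

theorem le_of_tendsto_of_hasDerivAt_nonneg {f f' : ℝ → ℝ} {c T : ℝ}
    (hd : ∀ s, 0 < s → HasDerivAt f (f' s) s) (hn : ∀ s ∈ Ioo 0 T, 0 ≤ f' s)
    (hlim : Tendsto f (𝓝[>] 0) (𝓝 c)) {t : ℝ} (ht : t ∈ Ioc 0 T) : c ≤ f t := by
  have hm := monotoneOn_Ioc_of_hasDerivAt_nonneg hd hn
  refine le_of_tendsto hlim ?_
  filter_upwards [Ioo_mem_nhdsGT ht.1] with s hs
  exact hm ⟨hs.1, hs.2.le.trans ht.2⟩ ht hs.2.le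

theorem le_add_mul_of_hasDerivAt_le {f f' : ℝ → ℝ} {c C T : ℝ}
    (hd : ∀ s, 0 < s → HasDerivAt f (f' s) s) (hn : ∀ s ∈ Ioo 0 T, f' s ≤ C)
    (hlim : Tendsto f (𝓝[>] 0) (𝓝 c)) {t : ℝ} (ht : t ∈ Ioc 0 T) : f t ≤ c + C * t := by
  have hl : Tendsto (fun s => C * s - f s) (𝓝[>] 0) (𝓝 (-c)) := by
    have h : Tendsto (fun s : ℝ => C * s) (𝓝[>] 0) (𝓝 0) := by
      have : Tendsto (fun s : ℝ => C * s) (𝓝 0) (𝓝 (C * 0)) := tendsto_id.const_mul C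
      rw [mul_zero] at this
      exact this.mono_left nhdsWithin_le_nhds
    simpa using h.sub hlim
  have h := le_of_tendsto_of_hasDerivAt_nonneg (f := fun s => C * s - f s)
    (f' := fun s => C * 1 - f' s)
    (fun s hs => ((hasDerivAt_id s).const_mul C).sub (hd s hs))
    (fun s hs => by linarith [hn s hs]) hl ht
  linarith

theorem eq_of_tendsto_of_hasDerivAt_zero {f : ℝ → ℝ} {c : ℝ}
    (hd : ∀ s, 0 < s → HasDerivAt f 0 s) (hlim : Tendsto f (𝓝[>] 0) (𝓝 c)) {t : ℝ}
    (ht : 0 < t) : f t = c := by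
  refine le_antisymm ?_ ?_
  · simpa using le_add_mul_of_hasDerivAt_le (C := 0) (T := t) hd (fun _ _ => le_rfl) hlim
      ⟨ht, le_rfl⟩
  · exact le_of_tendsto_of_hasDerivAt_nonneg (T := t) hd (fun _ _ => le_rfl) hlim ⟨ht, le_rfl⟩

/-- A function that decreases wherever it exceeds its initial value never exceeds it. -/
theorem le_of_tendsto_of_hasDerivAt_neg {f f' : ℝ → ℝ} {c T : ℝ}
    (hd : ∀ s, 0 < s → HasDerivAt f (f' s) s) (hn : ∀ s ∈ Ioo 0 T, c < f s → f' s < 0)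
    (hlim : Tendsto f (𝓝[>] 0) (𝓝 c)) {t : ℝ} (ht : t ∈ Ioc 0 T) : f t ≤ c := by
  -- The slack `d` makes the barrier strict: at a contact with `c + d` the function exceeds `c`,
  -- where its derivative is negative.
  refine le_of_forall_pos_le_add fun d hd0 => ?_
  obtain ⟨s, hs1, hs2⟩ := ((hlim.eventually (gt_mem_nhds (show c < c + d by linarith))).and
    (Ioo_mem_nhdsGT ht.1)).exists
  refine image_le_of_deriv_right_lt_deriv_boundary' (f := f) (f' := f') (a := s) (b := t)
    (B := fun _ => c + d) (B' := fun _ => 0)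
    (fun x hx => (hd x (lt_of_lt_of_le hs2.1 hx.1)).continuousAt.continuousWithinAt)
    (fun x hx => (hd x (lt_of_lt_of_le hs2.1 hx.1)).hasDerivWithinAt) hs1.le
    continuousOn_const (fun x _ => (hasDerivAt_const x _).hasDerivWithinAt)
    (fun x hx hfx => hn x ⟨lt_of_lt_of_le hs2.1 hx.1, lt_of_lt_of_le hx.2 ht.2⟩ (by linarith))
    ⟨hs2.2.le, le_rfl⟩

/-- Continuity method: a strict lower bound persists if it is improved at the first exit time. -/
theorem lt_of_continuity_method {f : ℝ → ℝ} {c T : ℝ} (hf : ContinuousOn f (Ioi 0))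
    (h0 : ∀ᶠ t in 𝓝[>] 0, c < f t)
    (h : ∀ u ∈ Ioc 0 T, (∀ s ∈ Ioo 0 u, c < f s) → c < f u) :
    ∀ t ∈ Ioc 0 T, c < f t := by
  by_contra! hcon
  obtain ⟨t, ht, hft⟩ := hcon
  obtain ⟨d, hd, hdf⟩ := mem_nhdsGT_iff_exists_Ioo_subset.1 h0
  have hd0 : (0 : ℝ) < d := hd
  have hsub : Icc d T ⊆ Ioi 0 := fun x hx => lt_of_lt_of_le hd0 hx.1
  -- The bound holds on `(0, d)`, so failures stay away from `0`; compactness then gives a first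
  -- failure time.
  have hcomp : IsCompact (Icc d T ∩ f ⁻¹' Iic c) :=
    isCompact_Icc.of_isClosed_subset
      ((hf.mono hsub).preimage_isClosed_of_isClosed isClosed_Icc isClosed_Iic) inter_subset_left
  have hge : ∀ s, 0 < s → f s ≤ c → d ≤ s := by
    intro s hs hfs
    by_contra! hlt
    exact absurd (hdf ⟨hs, hlt⟩) (not_lt.2 hfs)
  obtain ⟨u, ⟨hu1, hu2⟩, hmin⟩ := hcomp.exists_isLeast ⟨t, ⟨hge t ht.1 hft, ht.2⟩, hft⟩
  refine absurd (h u ⟨hsub hu1, hu1.2⟩ fun s hs => ?_) (not_lt.2 hu2)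
  by_contra! hfs
  exact absurd (hmin ⟨⟨hge s hs.1 hfs, hs.2.le.trans hu1.2⟩, hfs⟩) (not_le.2 hs.2)

theorem abs_le_of_gronwall {f f' : ℝ → ℝ} {K e T : ℝ} (hK : 0 < K)
    (hd : ∀ s ∈ Ioc 0 T, HasDerivAt f (f' s) s) (hb : ∀ s ∈ Ioc 0 T, |f' s| ≤ K * |f s| + e)
    (hlim : Tendsto f (𝓝[>] 0) (𝓝 0)) {t : ℝ} (ht : t ∈ Ioc 0 T) :
    |f t| ≤ e / K * (Real.exp (K * t) - 1) := by
  -- Gronwall is applied on `[d, t]`, and then `d → 0`, since `f` is only controlled by its limit at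
  -- `0`.
  have h1 : Tendsto (fun d => |f d| * Real.exp (K * (t - d)) +
      e / K * (Real.exp (K * (t - d)) - 1)) (𝓝[>] 0)
      (𝓝 (|0| * Real.exp (K * (t - 0)) + e / K * (Real.exp (K * (t - 0)) - 1))) := by
    have hx : Tendsto (fun d => Real.exp (K * (t - d))) (𝓝[>] 0) (𝓝 (Real.exp (K * (t - 0)))) :=
      (Continuous.tendsto (by fun_prop) 0).mono_left nhdsWithin_le_nhds
    exact (hlim.abs.mul hx).add ((hx.sub_const 1).const_mul _)
  simp only [abs_zero, zero_mul, zero_add, sub_zero] at h1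
  refine ge_of_tendsto h1 ?_
  filter_upwards [Ioo_mem_nhdsGT ht.1] with d hd'
  have hmem : ∀ s ∈ Icc d t, s ∈ Ioc 0 T := fun s hs =>
    ⟨lt_of_lt_of_le hd'.1 hs.1, hs.2.trans ht.2⟩
  have h := norm_le_gronwallBound_of_norm_deriv_right_le (f := f) (f' := f') (δ := |f d|)
    (K := K) (ε := e) (a := d) (b := t)
    (fun s hs => (hd s (hmem s hs)).continuousAt.continuousWithinAt)
    (fun s hs => (hd s (hmem s ⟨hs.1, hs.2.le⟩)).hasDerivWithinAt) le_rfl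
    (fun s hs => hb s (hmem s ⟨hs.1, hs.2.le⟩)) t ⟨hd'.2.le, le_rfl⟩
  rwa [gronwallBound_of_K_ne_0 hK.ne'] at h

/-! ### The rescaled system for the metric coefficients -/

/-- The system satisfied by the rescaled metric coefficients, with `e = r₀²`, together with the
behaviour at the singular orbit. -/
structure IsScaledFlow (e k : ℝ) (A₁ A₃ B₁ B₃ : ℝ → ℝ) : Prop where
  e_pos : 0 < e
  k_pos : 0 < k
  A₁_pos : ∀ t, 0 < t → 0 < A₁ t
  A₃_pos : ∀ t, 0 < t → 0 < A₃ t
  B₁_pos : ∀ t, 0 < t → 0 < B₁ t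
  B₃_pos : ∀ t, 0 < t → 0 < B₃ t
  ode_A₁ : ∀ t, 0 < t → HasDerivAt A₁
    ((B₁ t ^ 2 - e * A₁ t ^ 2 + B₃ t ^ 2) / (2 * B₁ t * B₃ t) - A₃ t / (2 * A₁ t)) t
  ode_A₃ : ∀ t, 0 < t → HasDerivAt A₃
    (A₃ t ^ 2 / 2 * (1 / A₁ t ^ 2 - e / B₁ t ^ 2)) t
  ode_B₁ : ∀ t, 0 < t → HasDerivAt B₁
    ((e * A₁ t ^ 2 - B₁ t ^ 2 + B₃ t ^ 2) / (2 * A₁ t * B₃ t) + e * A₃ t / (2 * B₁ t)) t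
  ode_B₃ : ∀ t, 0 < t → HasDerivAt B₃
    ((B₁ t ^ 2 + e * A₁ t ^ 2 - B₃ t ^ 2) / (A₁ t * B₁ t)) t
  lim_A₁ : Tendsto A₁ (𝓝[>] 0) (𝓝 0)
  lim_A₃ : Tendsto A₃ (𝓝[>] 0) (𝓝 0)
  lim_B₁ : Tendsto B₁ (𝓝[>] 0) (𝓝 2)
  lim_B₃ : Tendsto B₃ (𝓝[>] 0) (𝓝 2)
  lim_k : Tendsto (fun t => (A₁ t - A₃ t) / (A₁ t * A₃ t ^ 2)) (𝓝[>] 0) (𝓝 k)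

/-! ### Identities and sign information valid for all time. -/

namespace IsScaledFlow

variable {e k : ℝ} {A₁ A₃ B₁ B₃ : ℝ → ℝ}

/-- The first term pushes the ratio back to `1`; the second has the factor `e`, and when `A₃ ≤ A₁`
it can only push the ratio down from values at or above `1`. -/
theorem hasDerivAt_ratio (h : IsScaledFlow e k A₁ A₃ B₁ B₃) {t : ℝ} (ht : 0 < t) :
    HasDerivAt (fun s => B₁ s / B₃ s)
      (3 / (2 * A₁ t) * (1 - (B₁ t / B₃ t) ^ 2) -
        e / (2 * B₁ t * B₃ t) * (A₁ t * (B₁ t / B₃ t) - A₃ t)) t := by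
  have h1 := (h.A₁_pos t ht).ne'
  have h3 := (h.A₃_pos t ht).ne'
  have g1 := (h.B₁_pos t ht).ne'
  have g3 := (h.B₃_pos t ht).ne'
  refine ((h.ode_B₁ t ht).div (h.ode_B₃ t ht) g3).congr_deriv ?_
  field_simp
  ring

/-- In this form each term is visibly nonnegative once `A₃ ≤ A₁` and `B₁ ≤ B₃`, and all vanish when
`e = 0` and `B₁ = B₃`. -/
theorem hasDerivAt_kappa (h : IsScaledFlow e k A₁ A₃ B₁ B₃) {t : ℝ} (ht : 0 < t) :
    HasDerivAt (fun s => (A₁ s - A₃ s) / (A₁ s * A₃ s ^ 2))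
      (e * (1 - B₁ t / B₃ t) / (2 * A₃ t * B₁ t ^ 2) +
        e * ((A₁ t - A₃ t) / (A₁ t * A₃ t ^ 2)) * A₃ t / (2 * B₁ t ^ 2) +
        (1 - B₁ t / B₃ t) ^ 2 / (2 * (B₁ t / B₃ t) * A₁ t ^ 2 * A₃ t)) t := by
  have h1 := (h.A₁_pos t ht).ne'
  have h3 := (h.A₃_pos t ht).ne'
  have g1 := (h.B₁_pos t ht).ne'
  have g3 := (h.B₃_pos t ht).ne'
  refine (((h.ode_A₁ t ht).sub (h.ode_A₃ t ht)).div
    ((h.ode_A₁ t ht).mul ((h.ode_A₃ t ht).pow 2)) (mul_ne_zero h1 (pow_ne_zero 2 h3))).congr_deriv ?_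
  simp only [Pi.mul_apply, Pi.pow_apply, Pi.sub_apply]
  push_cast
  field_simp
  ring

/-- In the flow variables this is the rescaled form of `(2a + b + p) - (2a - b - p) - 2(b - p) =
4p`. -/
theorem conserved (h : IsScaledFlow e k A₁ A₃ B₁ B₃) {t : ℝ} (ht : 0 < t) :
    B₁ t ^ 2 * B₃ t - e * (A₁ t ^ 2 * B₃ t + 2 * A₁ t * A₃ t * B₁ t) = 8 := by
  refine eq_of_tendsto_of_hasDerivAt_zero
    (f := fun t => B₁ t ^ 2 * B₃ t - e * (A₁ t ^ 2 * B₃ t + 2 * A₁ t * A₃ t * B₁ t))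
    (fun s hs => ?_) ?_ ht
  · have h1 := (h.A₁_pos s hs).ne'
    have h3 := (h.A₃_pos s hs).ne'
    have g1 := (h.B₁_pos s hs).ne'
    have g3 := (h.B₃_pos s hs).ne'
    have d1 := h.ode_A₁ s hs
    have d2 := h.ode_A₃ s hs
    have d3 := h.ode_B₁ s hs
    have d4 := h.ode_B₃ s hs
    refine (((d3.pow 2).mul d4).sub ((((d1.pow 2).mul d4).add
      (((d1.const_mul 2).mul d2).mul d3)).const_mul e)).congr_deriv ?_
    simp only [Pi.mul_apply, Pi.pow_apply]
    push_cast
    field_simp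
    ring
  · have := ((h.lim_B₁.pow 2).mul h.lim_B₃).sub ((((h.lim_A₁.pow 2).mul h.lim_B₃).add
      (((h.lim_A₁.const_mul 2).mul h.lim_A₃).mul h.lim_B₁)).const_mul e)
    convert this using 2
    norm_num

theorem lim_ratio (h : IsScaledFlow e k A₁ A₃ B₁ B₃) :
    Tendsto (fun s => B₁ s / B₃ s) (𝓝[>] 0) (𝓝 1) := by
  have := h.lim_B₁.div h.lim_B₃ (by norm_num)
  rwa [div_self two_ne_zero] at this

theorem ratio_le_one_of_le (h : IsScaledFlow e k A₁ A₃ B₁ B₃) {T : ℝ}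
    (hA : ∀ s ∈ Ioo 0 T, A₃ s ≤ A₁ s) {t : ℝ} (ht : t ∈ Ioc 0 T) : B₁ t / B₃ t ≤ 1 := by
  refine le_of_tendsto_of_hasDerivAt_neg (fun s hs => h.hasDerivAt_ratio hs)
    (fun s hs hr => ?_) h.lim_ratio ht
  have h1 := h.A₁_pos s hs.1
  have g1 := h.B₁_pos s hs.1
  have g3 := h.B₃_pos s hs.1
  have e0 := h.e_pos
  have a := hA s hs
  have x1 : 3 / (2 * A₁ s) * (1 - (B₁ s / B₃ s) ^ 2) < 0 :=
    mul_neg_of_pos_of_neg (by positivity) (by nlinarith)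
  have x2 : 0 ≤ e / (2 * B₁ s * B₃ s) * (A₁ s * (B₁ s / B₃ s) - A₃ s) :=
    mul_nonneg (by positivity) (by nlinarith)
  linarith

/-- Bootstrap: up to a first exit time the bound gives `A₃ ≤ A₁`, hence `B₁ ≤ B₃`, hence `κ` is
nondecreasing and at least its initial value `k > k/2`. -/
theorem half_lt_kappa (h : IsScaledFlow e k A₁ A₃ B₁ B₃) {t : ℝ} (ht : 0 < t) :
    k / 2 < (A₁ t - A₃ t) / (A₁ t * A₃ t ^ 2) := by
  have k0 := h.k_pos
  refine lt_of_continuity_method (T := t)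
    (f := fun t => (A₁ t - A₃ t) / (A₁ t * A₃ t ^ 2))
    (fun s hs => (h.hasDerivAt_kappa hs).continuousAt.continuousWithinAt)
    (h.lim_k.eventually (lt_mem_nhds (by linarith))) (fun u hu hlt => ?_) t ⟨ht, le_rfl⟩
  have hA : ∀ s ∈ Ioo 0 u, A₃ s ≤ A₁ s := fun s hs => by
    have h1 := h.A₁_pos s hs.1
    have h3 := h.A₃_pos s hs.1
    have := (div_pos_iff_of_pos_right (by positivity)).1 (lt_trans (half_pos k0) (hlt s hs))
    linarith
  refine lt_of_lt_of_le (show k / 2 < k by linarith) ?_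
  refine le_of_tendsto_of_hasDerivAt_nonneg (T := u) (fun s hs => h.hasDerivAt_kappa hs)
    (fun s hs => ?_) h.lim_k ⟨hu.1, le_rfl⟩
  have h1 := h.A₁_pos s hs.1
  have h3 := h.A₃_pos s hs.1
  have g1 := h.B₁_pos s hs.1
  have g3 := h.B₃_pos s hs.1
  have e0 := h.e_pos
  have hr := h.ratio_le_one_of_le hA ⟨hs.1, hs.2.le⟩
  have hk : 0 ≤ (A₁ s - A₃ s) / (A₁ s * A₃ s ^ 2) := by linarith [hlt s hs]
  have hr' : 0 ≤ 1 - B₁ s / B₃ s := by linarith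
  positivity

theorem A₃_lt_A₁ (h : IsScaledFlow e k A₁ A₃ B₁ B₃) {t : ℝ} (ht : 0 < t) : A₃ t < A₁ t := by
  have h1 := h.A₁_pos t ht
  have h3 := h.A₃_pos t ht
  have := (div_pos_iff_of_pos_right (by positivity)).1
    (lt_trans (half_pos h.k_pos) (h.half_lt_kappa ht))
  linarith

theorem ratio_le_one (h : IsScaledFlow e k A₁ A₃ B₁ B₃) {t : ℝ} (ht : 0 < t) :
    B₁ t / B₃ t ≤ 1 :=
  h.ratio_le_one_of_le (fun _ hs => (h.A₃_lt_A₁ hs.1).le) ⟨ht, le_rfl⟩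

theorem kappa_pos (h : IsScaledFlow e k A₁ A₃ B₁ B₃) {t : ℝ} (ht : 0 < t) :
    0 < (A₁ t - A₃ t) / (A₁ t * A₃ t ^ 2) :=
  lt_trans (half_pos h.k_pos) (h.half_lt_kappa ht)

theorem kappa_deriv_nonneg (h : IsScaledFlow e k A₁ A₃ B₁ B₃) {t : ℝ} (ht : 0 < t) :
    0 ≤ e * (1 - B₁ t / B₃ t) / (2 * A₃ t * B₁ t ^ 2) +
        e * ((A₁ t - A₃ t) / (A₁ t * A₃ t ^ 2)) * A₃ t / (2 * B₁ t ^ 2) +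
        (1 - B₁ t / B₃ t) ^ 2 / (2 * (B₁ t / B₃ t) * A₁ t ^ 2 * A₃ t) := by
  have h1 := h.A₁_pos t ht
  have h3 := h.A₃_pos t ht
  have g1 := h.B₁_pos t ht
  have g3 := h.B₃_pos t ht
  have e0 := h.e_pos
  have hk := (h.kappa_pos ht).le
  have hr' : 0 ≤ 1 - B₁ t / B₃ t := by linarith [h.ratio_le_one ht]
  positivity

theorem le_kappa (h : IsScaledFlow e k A₁ A₃ B₁ B₃) {t : ℝ} (ht : 0 < t) :
    k ≤ (A₁ t - A₃ t) / (A₁ t * A₃ t ^ 2) :=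
  le_of_tendsto_of_hasDerivAt_nonneg (T := t)
    (f := fun t => (A₁ t - A₃ t) / (A₁ t * A₃ t ^ 2))
    (fun _ hs => h.hasDerivAt_kappa hs)
    (fun _ hs => h.kappa_deriv_nonneg hs.1) h.lim_k ⟨ht, le_rfl⟩

theorem B₁_le_B₃ (h : IsScaledFlow e k A₁ A₃ B₁ B₃) {t : ℝ} (ht : 0 < t) : B₁ t ≤ B₃ t :=
  (div_le_one (h.B₃_pos t ht)).1 (h.ratio_le_one ht)

theorem eight_le (h : IsScaledFlow e k A₁ A₃ B₁ B₃) {t : ℝ} (ht : 0 < t) :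
    8 ≤ B₁ t ^ 2 * B₃ t := by
  have h1 := h.A₁_pos t ht
  have h3 := h.A₃_pos t ht
  have g1 := h.B₁_pos t ht
  have g3 := h.B₃_pos t ht
  have e0 := h.e_pos
  have : 0 ≤ e * (A₁ t ^ 2 * B₃ t + 2 * A₁ t * A₃ t * B₁ t) := by positivity
  linarith [h.conserved ht]

theorem two_le_B₃ (h : IsScaledFlow e k A₁ A₃ B₁ B₃) {t : ℝ} (ht : 0 < t) : 2 ≤ B₃ t := by
  have g1 := h.B₁_pos t ht
  have g3 := h.B₃_pos t ht
  have h2 : B₁ t ^ 2 ≤ B₃ t ^ 2 := pow_le_pow_left₀ g1.le (h.B₁_le_B₃ ht) 2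
  have h3 := h.eight_le ht
  by_contra! hlt
  have h4 : B₃ t ^ 3 < 2 ^ 3 := pow_lt_pow_left₀ hlt g3.le (by norm_num)
  nlinarith

theorem four_le_mul (h : IsScaledFlow e k A₁ A₃ B₁ B₃) {t : ℝ} (ht : 0 < t) :
    4 ≤ B₁ t * B₃ t := by
  have g1 := h.B₁_pos t ht
  have g3 := h.B₃_pos t ht
  have h3 := h.eight_le ht
  have h2 := h.two_le_B₃ ht
  have : (4 : ℝ) ^ 2 ≤ (B₁ t * B₃ t) ^ 2 := by nlinarith
  exact le_of_sq_le_sq this (by positivity)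

theorem A₁_le_of_half_lt (h : IsScaledFlow e k A₁ A₃ B₁ B₃) {T : ℝ}
    (hr : ∀ s ∈ Ioo 0 T, 1 / 2 < B₁ s / B₃ s) {t : ℝ} (ht : t ∈ Ioc 0 T) :
    A₁ t ≤ 5 / 4 * t := by
  have := le_add_mul_of_hasDerivAt_le (C := 5 / 4) h.ode_A₁ (fun s hs => ?_) h.lim_A₁ ht
  · linarith
  have h1 := h.A₁_pos s hs.1
  have h3 := h.A₃_pos s hs.1
  have g1 := h.B₁_pos s hs.1
  have g3 := h.B₃_pos s hs.1
  have e0 := h.e_pos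
  have x1 : 0 ≤ A₃ s / (2 * A₁ s) := by positivity
  have x2 : (B₁ s ^ 2 - e * A₁ s ^ 2 + B₃ s ^ 2) / (2 * B₁ s * B₃ s) ≤ 5 / 4 := by
    rw [div_le_iff₀ (by positivity)]
    have x3 := (lt_div_iff₀ g3).1 (hr s hs)
    have x4 := h.B₁_le_B₃ hs.1
    have x5 : 0 ≤ e * A₁ s ^ 2 := by positivity
    -- The product is `5 B₁ B₃ - 2 B₁² - 2 B₃²`; this is where the constant `5/4` comes from.
    nlinarith [mul_nonneg (show 0 ≤ 2 * B₁ s - B₃ s by linarith)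
      (show 0 ≤ 2 * B₃ s - B₁ s by linarith)]
  linarith

theorem one_sub_ratio_le_of (h : IsScaledFlow e k A₁ A₃ B₁ B₃) {T M : ℝ}
    (hM : ∀ s ∈ Ioo 0 T, A₁ s - A₃ s ≤ M) {t : ℝ} (ht : t ∈ Ioc 0 T) :
    1 - B₁ t / B₃ t ≤ e / 8 * M * t := by
  have hl : Tendsto (fun s => 1 - B₁ s / B₃ s) (𝓝[>] 0) (𝓝 0) := by
    simpa using h.lim_ratio.const_sub 1
  have := le_add_mul_of_hasDerivAt_le (f := fun s => 1 - B₁ s / B₃ s) (C := e / 8 * M)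
    (fun s hs => (h.hasDerivAt_ratio hs).const_sub 1) (fun s hs => ?_) hl ht
  · linarith
  have h1 := h.A₁_pos s hs.1
  have h3 := h.A₃_pos s hs.1
  have g1 := h.B₁_pos s hs.1
  have g3 := h.B₃_pos s hs.1
  have e0 := h.e_pos
  have hr := h.ratio_le_one hs.1
  have hr0 : 0 < B₁ s / B₃ s := by positivity
  have hA := h.A₃_lt_A₁ hs.1
  have x1 : 0 ≤ 3 / (2 * A₁ s) * (1 - (B₁ s / B₃ s) ^ 2) :=
    mul_nonneg (by positivity) (by nlinarith)
  have x2 : A₁ s * (B₁ s / B₃ s) - A₃ s ≤ A₁ s - A₃ s := by nlinarith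
  have x3 : e / (2 * B₁ s * B₃ s) ≤ e / 8 :=
    div_le_div_of_nonneg_left e0.le (by norm_num) (by linarith [h.four_le_mul hs.1])
  have x4 : e / (2 * B₁ s * B₃ s) * (A₁ s * (B₁ s / B₃ s) - A₃ s) ≤ e / 8 * M :=
    calc _ ≤ e / (2 * B₁ s * B₃ s) * (A₁ s - A₃ s) :=
          mul_le_mul_of_nonneg_left x2 (by positivity)
      _ ≤ e / 8 * (A₁ s - A₃ s) := mul_le_mul_of_nonneg_right x3 (by linarith)
      _ ≤ e / 8 * M := mul_le_mul_of_nonneg_left (hM s hs) (by positivity)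
  linarith

/-! ### Estimates on `(0, T]` under `e T² ≤ 1`. -/

section ShortTime

variable {T : ℝ}

/-- Bootstrap: the bound implies `A₁ ≤ 5u/4` before `u`, so `1 - B₁/B₃ ≤ 5 e u² / 32 < 1/2` at `u`.
-/
theorem half_lt_ratio (h : IsScaledFlow e k A₁ A₃ B₁ B₃) (hT : e * T ^ 2 ≤ 1) :
    ∀ t ∈ Ioc 0 T, 1 / 2 < B₁ t / B₃ t := by
  refine lt_of_continuity_method (f := fun s => B₁ s / B₃ s)
    (fun s hs => (h.hasDerivAt_ratio hs).continuousAt.continuousWithinAt)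
    (h.lim_ratio.eventually (lt_mem_nhds (by norm_num))) (fun u hu hlt => ?_)
  have e0 := h.e_pos
  have hM : ∀ s ∈ Ioo 0 u, A₁ s - A₃ s ≤ 5 / 4 * u := fun s hs => by
    linarith [h.A₁_le_of_half_lt hlt ⟨hs.1, hs.2.le⟩, h.A₃_pos s hs.1, hs.2]
  have h1 := h.one_sub_ratio_le_of hM ⟨hu.1, le_rfl⟩
  have h2 : e * u ^ 2 ≤ 1 :=
    (mul_le_mul_of_nonneg_left (pow_le_pow_left₀ hu.1.le hu.2 2) e0.le).trans hT
  nlinarith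

theorem A₁_le (h : IsScaledFlow e k A₁ A₃ B₁ B₃) (hT : e * T ^ 2 ≤ 1) {t : ℝ}
    (ht : t ∈ Ioc 0 T) : A₁ t ≤ 5 / 4 * t :=
  h.A₁_le_of_half_lt (fun s hs => h.half_lt_ratio hT s ⟨hs.1, hs.2.le⟩) ht

theorem one_le_B₁ (h : IsScaledFlow e k A₁ A₃ B₁ B₃) (hT : e * T ^ 2 ≤ 1) {t : ℝ}
    (ht : t ∈ Ioc 0 T) : 1 ≤ B₁ t := by
  have h1 := (lt_div_iff₀ (h.B₃_pos t ht.1)).1 (h.half_lt_ratio hT t ht)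
  linarith [h.two_le_B₃ ht.1]

theorem mul_A₁_sq_le (h : IsScaledFlow e k A₁ A₃ B₁ B₃) (hT : e * T ^ 2 ≤ 1) {t : ℝ}
    (ht : t ∈ Ioc 0 T) : e * A₁ t ^ 2 ≤ 25 / 16 * (e * T ^ 2) := by
  have h1 := h.A₁_pos t ht.1
  have h2 := (h.A₁_le hT ht).trans (mul_le_mul_of_nonneg_left ht.2 (by norm_num))
  have h3 := mul_le_mul_of_nonneg_left (pow_le_pow_left₀ h1.le h2 2) h.e_pos.le
  linarith

theorem monotoneOn_A₁ (h : IsScaledFlow e k A₁ A₃ B₁ B₃) (hT : e * T ^ 2 ≤ 1) :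
    MonotoneOn A₁ (Ioc 0 T) := by
  refine monotoneOn_Ioc_of_hasDerivAt_nonneg h.ode_A₁ fun s hs => ?_
  have h1 := h.A₁_pos s hs.1
  have g1 := h.B₁_pos s hs.1
  have g3 := h.B₃_pos s hs.1
  have x1 : A₃ s / (2 * A₁ s) ≤ 1 / 2 := by
    rw [div_le_div_iff₀ (by positivity) (by norm_num)]
    linarith [h.A₃_lt_A₁ hs.1]
  have x2 : 1 / 2 ≤ (B₁ s ^ 2 - e * A₁ s ^ 2 + B₃ s ^ 2) / (2 * B₁ s * B₃ s) := by
    rw [le_div_iff₀ (by positivity)]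
    have := h.mul_A₁_sq_le hT ⟨hs.1, hs.2.le⟩
    have := h.four_le_mul hs.1
    nlinarith [sq_nonneg (B₁ s - B₃ s)]
  linarith

theorem monotoneOn_A₃ (h : IsScaledFlow e k A₁ A₃ B₁ B₃) (hT : e * T ^ 2 ≤ 1) :
    MonotoneOn A₃ (Ioc 0 T) := by
  have hb : ∀ t ∈ Ioc 0 T, e * A₁ t ^ 2 ≤ B₁ t ^ 2 := by
    intro t ht
    have hm := h.B₁_le_B₃ ht.1
    have hr := (lt_div_iff₀ (h.B₃_pos t ht.1)).1 (h.half_lt_ratio hT t ht)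
    have := h.mul_A₁_sq_le hT ht
    nlinarith [h.four_le_mul ht.1, h.B₁_pos t ht.1]
  refine monotoneOn_Ioc_of_hasDerivAt_nonneg h.ode_A₃ fun s hs => ?_
  have h1 := h.A₁_pos s hs.1
  have h3 := h.A₃_pos s hs.1
  have g1 := h.B₁_pos s hs.1
  refine mul_nonneg (by positivity) (sub_nonneg.2 ?_)
  rw [div_le_div_iff₀ (by positivity) (by positivity), one_mul]
  exact hb s ⟨hs.1, hs.2.le⟩

theorem sub_eq_kappa_mul (h : IsScaledFlow e k A₁ A₃ B₁ B₃) {t : ℝ} (ht : 0 < t) :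
    A₁ t - A₃ t = (A₁ t - A₃ t) / (A₁ t * A₃ t ^ 2) * (A₁ t * A₃ t ^ 2) := by
  have h1 := h.A₁_pos t ht
  have h3 := h.A₃_pos t ht
  rw [div_mul_cancel₀ _ (by positivity)]

theorem kappa_mul_sq (h : IsScaledFlow e k A₁ A₃ B₁ B₃) {t : ℝ} (ht : 0 < t) :
    (A₁ t - A₃ t) / (A₁ t * A₃ t ^ 2) * A₃ t ^ 2 = 1 - A₃ t / A₁ t := by
  have h1 := (h.A₁_pos t ht).ne'
  have h3 := (h.A₃_pos t ht).ne'
  field_simp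

theorem monotoneOn_kappa (h : IsScaledFlow e k A₁ A₃ B₁ B₃) :
    MonotoneOn (fun t => (A₁ t - A₃ t) / (A₁ t * A₃ t ^ 2)) (Ioc 0 T) :=
  monotoneOn_Ioc_of_hasDerivAt_nonneg (fun _ hs => h.hasDerivAt_kappa hs)
    (fun _ hs => h.kappa_deriv_nonneg hs.1)

/-- The difference is `κ A₁ A₃²`, a product of positive nondecreasing functions. Its supremum up to
time `t` is therefore its value at `t`, which makes `one_sub_ratio_le` a pointwise bound. -/
theorem monotoneOn_sub (h : IsScaledFlow e k A₁ A₃ B₁ B₃) (hT : e * T ^ 2 ≤ 1) :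
    MonotoneOn (fun t => A₁ t - A₃ t) (Ioc 0 T) := by
  intro s hs t ht hst
  simp only
  rw [h.sub_eq_kappa_mul hs.1, h.sub_eq_kappa_mul ht.1]
  have h1 := h.A₁_pos s hs.1
  have h3 := h.A₃_pos s hs.1
  exact mul_le_mul (h.monotoneOn_kappa hs ht hst)
    (mul_le_mul (h.monotoneOn_A₁ hT hs ht hst)
      (pow_le_pow_left₀ h3.le (h.monotoneOn_A₃ hT hs ht hst) 2) (by positivity)
      (h.A₁_pos t ht.1).le) (by positivity) (h.kappa_pos ht.1).le

theorem one_sub_ratio_le (h : IsScaledFlow e k A₁ A₃ B₁ B₃) (hT : e * T ^ 2 ≤ 1) {t : ℝ}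
    (ht : t ∈ Ioc 0 T) : 1 - B₁ t / B₃ t ≤ e / 8 * (A₁ t - A₃ t) * t :=
  h.one_sub_ratio_le_of (T := t)
    (fun _ hs => h.monotoneOn_sub hT ⟨hs.1, hs.2.le.trans ht.2⟩ ht hs.2.le) ⟨ht.1, le_rfl⟩

theorem one_sub_ratio_le' (h : IsScaledFlow e k A₁ A₃ B₁ B₃) (hT : e * T ^ 2 ≤ 1) {t : ℝ}
    (ht : t ∈ Ioc 0 T) : 1 - B₁ t / B₃ t ≤ e * T ^ 2 / 4 := by
  have h1 := h.A₁_le hT ht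
  have h3 := h.A₃_pos t ht.1
  have e0 := h.e_pos
  have x : (A₁ t - A₃ t) * t ≤ 2 * T * T :=
    mul_le_mul (by linarith [ht.1, ht.2]) ht.2 ht.1.le (by linarith [ht.1, ht.2])
  have := mul_le_mul_of_nonneg_left x (show 0 ≤ e / 8 by positivity)
  linarith [h.one_sub_ratio_le hT ht]

/-- Writing `A₁ - A₃ = κ A₁ A₃²` in the bound for `1 - B₁/B₃` cancels the negative powers of `A₁`
and `A₃` and makes every term a multiple of `e T κ`; the shares are `1/8 + 5/8 + 1/8 < 1`. -/
theorem kappa_deriv_le (h : IsScaledFlow e k A₁ A₃ B₁ B₃) (hT : e * T ^ 2 ≤ 1) {t : ℝ}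
    (ht : t ∈ Ioc 0 T) :
    e * (1 - B₁ t / B₃ t) / (2 * A₃ t * B₁ t ^ 2) +
        e * ((A₁ t - A₃ t) / (A₁ t * A₃ t ^ 2)) * A₃ t / (2 * B₁ t ^ 2) +
        (1 - B₁ t / B₃ t) ^ 2 / (2 * (B₁ t / B₃ t) * A₁ t ^ 2 * A₃ t) ≤
      e * T * ((A₁ t - A₃ t) / (A₁ t * A₃ t ^ 2)) := by
  have h1 := h.A₁_pos t ht.1
  have h3 := h.A₃_pos t ht.1
  have g1 := h.one_le_B₁ hT ht
  have e0 := h.e_pos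
  have T0 : 0 < T := ht.1.trans_le ht.2
  have hr := h.half_lt_ratio hT t ht
  have hs0 : 0 ≤ 1 - B₁ t / B₃ t := by linarith [h.ratio_le_one ht.1]
  have hs := h.one_sub_ratio_le hT ht
  have hK := h.kappa_pos ht.1
  have hKA := h.kappa_mul_sq ht.1
  have hx : 0 < A₃ t / A₁ t := by positivity
  rw [h.sub_eq_kappa_mul ht.1] at hs
  have hA3 : A₃ t ≤ 5 / 4 * T := by linarith [h.A₁_le hT ht, h.A₃_lt_A₁ ht.1, ht.2]
  have hA1 := h.mul_A₁_sq_le hT ht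
  have hA := h.A₃_lt_A₁ ht.1
  have hB : 1 ≤ B₁ t ^ 2 := one_le_pow₀ g1
  generalize 1 - B₁ t / B₃ t = σ at *
  generalize (A₁ t - A₃ t) / (A₁ t * A₃ t ^ 2) = K at *
  generalize B₁ t / B₃ t = r at *
  have hs' : σ ≤ e / 8 * T * K * A₁ t * A₃ t ^ 2 := by
    refine hs.trans ?_
    have : 0 ≤ e / 8 * (K * (A₁ t * A₃ t ^ 2)) := by positivity
    nlinarith [mul_le_mul_of_nonneg_left ht.2 this]
  have t1 : e * σ / (2 * A₃ t * B₁ t ^ 2) ≤ 1 / 8 * (e * T * K) := by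
    rw [div_le_iff₀ (by positivity)]
    have a1 : e * σ ≤ e * (e / 8 * T * K * A₁ t * A₃ t ^ 2) := mul_le_mul_of_nonneg_left hs' e0.le
    have a2 : e * (A₁ t * A₃ t) ≤ 2 := by nlinarith
    have a3 : e * T * K * A₃ t / 8 * (e * (A₁ t * A₃ t)) ≤ e * T * K * A₃ t / 8 * 2 :=
      mul_le_mul_of_nonneg_left a2 (by positivity)
    have a4 : e * T * K * A₃ t / 4 * 1 ≤ e * T * K * A₃ t / 4 * B₁ t ^ 2 :=
      mul_le_mul_of_nonneg_left hB (by positivity)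
    linarith
  have t2 : e * K * A₃ t / (2 * B₁ t ^ 2) ≤ 5 / 8 * (e * T * K) := by
    rw [div_le_iff₀ (by positivity)]
    have a1 : e * K * A₃ t ≤ e * K * (5 / 4 * T) := mul_le_mul_of_nonneg_left hA3 (by positivity)
    have a2 : e * T * K * 1 ≤ e * T * K * B₁ t ^ 2 := mul_le_mul_of_nonneg_left hB (by positivity)
    linarith
  have t3 : σ ^ 2 / (2 * r * A₁ t ^ 2 * A₃ t) ≤ 1 / 8 * (e * T * K) := by
    rw [div_le_iff₀ (by positivity)]
    have a1 : σ ^ 2 ≤ (e / 8 * T * K * A₁ t * A₃ t ^ 2) ^ 2 := pow_le_pow_left₀ hs0 hs' 2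
    have a2 : K * A₃ t ^ 2 ≤ 1 := by linarith
    have a3 : e / 64 * T ^ 2 * K * A₃ t ^ 2 ≤ 1 := by
      have : e * T ^ 2 * (K * A₃ t ^ 2) ≤ 1 * 1 := mul_le_mul hT a2 (by positivity) (by norm_num)
      linarith
    have a4 : e * K * A₁ t ^ 2 * A₃ t * (e / 64 * T ^ 2 * K * A₃ t ^ 2) * A₃ t ≤
        e * K * A₁ t ^ 2 * A₃ t * (1 / 64) * (5 / 4 * T) := by
      refine mul_le_mul ?_ hA3 h3.le (by positivity)
      refine mul_le_mul_of_nonneg_left ?_ (by positivity)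
      have : e * T ^ 2 * (K * A₃ t ^ 2) ≤ 1 * 1 := mul_le_mul hT a2 (by positivity) (by norm_num)
      linarith
    have a5 : e * T * K * A₁ t ^ 2 * A₃ t / 4 * (1 / 2) ≤
        e * T * K * A₁ t ^ 2 * A₃ t / 4 * r := mul_le_mul_of_nonneg_left hr.le (by positivity)
    have a6 : 0 ≤ e * T * K * A₁ t ^ 2 * A₃ t := by positivity
    nlinarith
  have : 0 ≤ e * T * K := by positivity
  linarith

theorem kappa_le (h : IsScaledFlow e k A₁ A₃ B₁ B₃) (hT : e * T ^ 2 ≤ 1) {t : ℝ}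
    (ht : t ∈ Ioc 0 T) :
    (A₁ t - A₃ t) / (A₁ t * A₃ t ^ 2) ≤ k * (1 + 2 * (e * T ^ 2)) := by
  have k0 := h.k_pos
  have e0 := h.e_pos
  have T0 : 0 < T := ht.1.trans_le ht.2
  -- Integrating `(log κ)' ≤ e T` gives `κ ≤ k exp(e T²)`, and `exp x ≤ 1 + 2x` on `[0, 1]`.
  have hl := le_add_mul_of_hasDerivAt_le (C := e * T)
    (f := fun t => Real.log ((A₁ t - A₃ t) / (A₁ t * A₃ t ^ 2)))
    (fun s hs => (h.hasDerivAt_kappa hs).log (h.kappa_pos hs).ne')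
    (fun s hs => by
      rw [div_le_iff₀ (h.kappa_pos hs.1)]
      exact h.kappa_deriv_le hT ⟨hs.1, hs.2.le⟩) (h.lim_k.log k0.ne') ht
  have h1 : Real.log ((A₁ t - A₃ t) / (A₁ t * A₃ t ^ 2)) ≤ Real.log k + e * T ^ 2 := by
    have := mul_le_mul_of_nonneg_left ht.2 (show 0 ≤ e * T by positivity)
    linarith
  have h2 := Real.exp_le_exp.2 h1
  rw [Real.exp_log (h.kappa_pos ht.1), Real.exp_add, Real.exp_log k0] at h2
  refine h2.trans (mul_le_mul_of_nonneg_left ?_ k0.le)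
  have hx : 0 ≤ e * T ^ 2 := by positivity
  have := Real.abs_exp_sub_one_le (x := e * T ^ 2) (by rwa [abs_of_nonneg hx])
  rw [abs_of_nonneg hx] at this
  linarith [le_abs_self (Real.exp (e * T ^ 2) - 1)]

theorem abs_B₁_sub_two_le (h : IsScaledFlow e k A₁ A₃ B₁ B₃) (hT : e * T ^ 2 ≤ 1) {t : ℝ}
    (ht : t ∈ Ioc 0 T) : |B₁ t - 2| ≤ 5 / 4 * (e * T ^ 2) := by
  have h1 := h.A₁_pos t ht.1
  have h3 := h.A₃_pos t ht.1
  have g1 := h.B₁_pos t ht.1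
  have g3 := h.B₃_pos t ht.1
  have e0 := h.e_pos
  have hc := h.conserved ht.1
  have hB := h.two_le_B₃ ht.1
  have hm := h.mul_A₁_sq_le hT ht
  have hx : 0 ≤ e * T ^ 2 := by positivity
  have hr := h.one_sub_ratio_le' hT ht
  have hr' : B₁ t = B₁ t / B₃ t * B₃ t := by field_simp
  rw [abs_le]
  constructor
  · have h2 := h.ratio_le_one ht.1
    have h0 : 0 < B₁ t / B₃ t := by positivity
    nlinarith
  · have a0 : A₁ t * A₃ t * B₁ t ≤ A₁ t * A₁ t * B₃ t :=
      mul_le_mul (mul_le_mul_of_nonneg_left (h.A₃_lt_A₁ ht.1).le h1.le) (h.B₁_le_B₃ ht.1) g1.le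
        (by positivity)
    have a1 : e * (A₁ t ^ 2 * B₃ t + 2 * A₁ t * A₃ t * B₁ t) ≤ 3 * (e * A₁ t ^ 2) * B₃ t := by
      nlinarith
    -- The conservation law bounds the left side by `8`, and `8 ≤ 4 B₃`.
    have a2 : (B₁ t ^ 2 - 3 * (e * A₁ t ^ 2)) * B₃ t ≤ 4 * B₃ t := by nlinarith
    have a3 := le_of_mul_le_mul_right a2 g3
    nlinarith

theorem abs_B₃_sub_two_le (h : IsScaledFlow e k A₁ A₃ B₁ B₃) (hT : e * T ^ 2 ≤ 1) {t : ℝ}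
    (ht : t ∈ Ioc 0 T) : |B₃ t - 2| ≤ 3 * (e * T ^ 2) := by
  have g3 := h.B₃_pos t ht.1
  have h1 := h.one_sub_ratio_le' hT ht
  have h2 := (lt_div_iff₀ g3).1 (h.half_lt_ratio hT t ht)
  have h3 := (abs_le.1 (h.abs_B₁_sub_two_le hT ht)).2
  have h4 := h.two_le_B₃ ht.1
  have hr' : B₁ t / B₃ t * B₃ t = B₁ t := by field_simp
  have hx : 0 ≤ e * T ^ 2 := mul_nonneg h.e_pos.le (sq_nonneg T)
  rw [abs_of_nonneg (by linarith)]
  have h5 : B₃ t ≤ 7 := by linarith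
  nlinarith

end ShortTime
end IsScaledFlow

/-! ### The Taub-NUT coefficients -/

theorem taubNUTPrim_taubNUTEta {m t : ℝ} (hm : 0 < m) (ht : 0 < t) :
    taubNUTPrim m (taubNUTEta m t) = -t := by
  have h := taubNUTEta_spec hm ht
  rw [taubNUTTime_eq hm h.1] at h
  linarith [h.2]

theorem taubNUTEta_strictAntiOn {m : ℝ} (hm : 0 < m) : StrictAntiOn (taubNUTEta m) (Ioi 0) := by
  intro s hs t ht hst
  rw [← (taubNUTPrim_strictMonoOn hm).lt_iff_lt (taubNUTEta_spec hm ht).1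
    (taubNUTEta_spec hm hs).1, taubNUTPrim_taubNUTEta hm hs, taubNUTPrim_taubNUTEta hm ht]
  linarith

theorem taubNUTEta_taubNUTTime {m x : ℝ} (hm : 0 < m) (hx : 1 / m ^ 2 < x) :
    taubNUTEta m (taubNUTTime m x) = x :=
  (taubNUTTime_bijOn hm).injOn.leftInvOn_invFunOn hx

theorem continuousAt_taubNUTEta {m t : ℝ} (hm : 0 < m) (ht : 0 < t) :
    ContinuousAt (taubNUTEta m) t := by
  have h : ContinuousAt (fun s => -taubNUTEta m s) t := by
    refine continuousAt_of_monotoneOn_of_image_mem_nhds (s := Ioi 0)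
      (fun a ha b hb hab => neg_le_neg ((taubNUTEta_strictAntiOn hm).antitoneOn ha hb hab))
      (Ioi_mem_nhds ht) ?_
    refine mem_of_superset (Iio_mem_nhds (neg_lt_neg (taubNUTEta_spec hm ht).1)) fun y hy => ?_
    have hy' : 1 / m ^ 2 < -y := by
      have : y < -(1 / m ^ 2) := hy
      linarith
    exact ⟨taubNUTTime m (-y), (taubNUTTime_bijOn hm).mapsTo hy', by
      simp only [taubNUTEta_taubNUTTime hm hy', neg_neg]⟩
  exact h.neg.congr (Eventually.of_forall fun s => neg_neg _)

theorem hasDerivAt_taubNUTEta {m t : ℝ} (hm : 0 < m) (ht : 0 < t) :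
    HasDerivAt (taubNUTEta m)
      (-(√(taubNUTEta m t) / (taubNUTEta m t - 1 / m ^ 2) ^ 2))⁻¹ t := by
  have h := (taubNUTEta_spec hm ht).1
  have h0 : 0 < taubNUTEta m t := lt_trans (by positivity) h
  have h1 : 0 < taubNUTEta m t - 1 / m ^ 2 := sub_pos.2 h
  have h2 := Real.sqrt_pos.2 h0
  refine HasDerivAt.of_local_left_inverse (continuousAt_taubNUTEta hm ht)
    (hasDerivAt_taubNUTPrim hm h).neg (neg_ne_zero.2 (by positivity)) ?_
  filter_upwards [Ioi_mem_nhds ht] with s hs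
  simp [taubNUTPrim_taubNUTEta hm hs]

/-- The autonomous equation for `f₃` against which `A₃` is compared. -/
theorem hasDerivAt_inv_sqrt_taubNUTEta {m t : ℝ} (hm : 0 < m) (ht : 0 < t) :
    HasDerivAt (fun s => (√(taubNUTEta m s))⁻¹)
      ((1 - 1 / m ^ 2 * (√(taubNUTEta m t))⁻¹ ^ 2) ^ 2 / 2) t := by
  have h := (taubNUTEta_spec hm ht).1
  have h0 : 0 < taubNUTEta m t := lt_trans (by positivity) h
  have h1 : 0 < taubNUTEta m t - 1 / m ^ 2 := sub_pos.2 h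
  have h2 := Real.sqrt_pos.2 h0
  refine (((hasDerivAt_taubNUTEta hm ht).sqrt h0.ne').inv h2.ne').congr_deriv ?_
  have hs : taubNUTEta m t = √(taubNUTEta m t) ^ 2 := (Real.sq_sqrt h0.le).symm
  set s := √(taubNUTEta m t)
  rw [hs] at h1 ⊢
  set q := 1 / m ^ 2
  field_simp

theorem inv_sqrt_taubNUTEta_le {m t : ℝ} (hm : 0 < m) (ht : 0 < t) :
    (√(taubNUTEta m t))⁻¹ ≤ t := by
  have h := (taubNUTEta_spec hm ht).1
  have q0 : 0 < 1 / m ^ 2 := by positivity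
  have h0 : 0 < taubNUTEta m t := lt_trans q0 h
  have h1 : 0 < taubNUTEta m t - 1 / m ^ 2 := sub_pos.2 h
  have h2 := Real.sqrt_pos.2 h0
  have h3 := taubNUTPrim_le hm h
  rw [taubNUTPrim_taubNUTEta hm ht] at h3
  refine le_trans ?_ (neg_le_neg_iff.1 h3)
  rw [inv_eq_one_div, div_le_div_iff₀ h2 h1, Real.mul_self_sqrt h0.le]
  linarith

theorem tendsto_inv_sqrt_taubNUTEta {m : ℝ} (hm : 0 < m) :
    Tendsto (fun s => (√(taubNUTEta m s))⁻¹) (𝓝[>] 0) (𝓝 0) := by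
  refine tendsto_of_tendsto_of_tendsto_of_le_of_le' tendsto_const_nhds
    (tendsto_nhdsWithin_of_tendsto_nhds tendsto_id) (Eventually.of_forall fun s => by positivity) ?_
  filter_upwards [self_mem_nhdsWithin] with s hs
  exact inv_sqrt_taubNUTEta_le hm hs

/-- `f₃ = (1 - m⁻² f₃²) f₁`. -/
theorem taubNUT_mul_one_sub {m t : ℝ} (hm : 0 < m) (ht : 0 < t) :
    √(taubNUTEta m t) * (taubNUTEta m t - 1 / m ^ 2)⁻¹ *
      (1 - 1 / m ^ 2 * (√(taubNUTEta m t))⁻¹ ^ 2) = (√(taubNUTEta m t))⁻¹ := by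
  have h := (taubNUTEta_spec hm ht).1
  have q0 : 0 < 1 / m ^ 2 := by positivity
  have h0 : 0 < taubNUTEta m t := lt_trans q0 h
  have h1 : 0 < taubNUTEta m t - 1 / m ^ 2 := sub_pos.2 h
  have h2 := Real.sqrt_pos.2 h0
  have hs : taubNUTEta m t = √(taubNUTEta m t) ^ 2 := (Real.sq_sqrt h0.le).symm
  set s := √(taubNUTEta m t)
  rw [hs] at h1 ⊢
  set q := 1 / m ^ 2
  field_simp

theorem exists_pos_le_one_sub_taubNUT {m T : ℝ} (hm : 0 < m) (hT : 0 < T) :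
    ∃ c, 0 < c ∧ ∀ t ∈ Ioc 0 T, c ≤ 1 - 1 / m ^ 2 * (√(taubNUTEta m t))⁻¹ ^ 2 := by
  have q0 : 0 < 1 / m ^ 2 := by positivity
  have h := (taubNUTEta_spec hm hT).1
  have h0 : 0 < taubNUTEta m T := lt_trans q0 h
  refine ⟨1 - 1 / m ^ 2 * (taubNUTEta m T)⁻¹, ?_, fun t ht => ?_⟩
  · rw [sub_pos, ← div_eq_mul_inv, div_lt_one h0]
    exact h
  · have h1 := (taubNUTEta_strictAntiOn hm).antitoneOn ht.1 (mem_Ioi.2 hT) ht.2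
    rw [inv_pow, Real.sq_sqrt (h0.le.trans h1)]
    have := mul_le_mul_of_nonneg_left (inv_anti₀ h0 h1) q0.le
    linarith

/-- Quantitative convergence of the rescaled coefficients to the Taub-NUT coefficients. -/
theorem exists_bound_taubNUT {m T : ℝ} (hm : 0 < m) (hT : 0 < T) :
    ∃ C : ℝ, ∀ (e : ℝ) (A₁ A₃ B₁ B₃ : ℝ → ℝ),
      IsScaledFlow e (1 / m ^ 2 - e / 8) A₁ A₃ B₁ B₃ → e * T ^ 2 ≤ 1 → ∀ t ∈ Ioc 0 T,
        |A₁ t - √(taubNUTEta m t) * (taubNUTEta m t - 1 / m ^ 2)⁻¹| ≤ C * e ∧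
        |A₃ t - (√(taubNUTEta m t))⁻¹| ≤ C * e := by
  obtain ⟨c, c0, hc⟩ := exists_pos_le_one_sub_taubNUT hm hT
  set q := 1 / m ^ 2 with hq
  have q0 : 0 < q := by positivity
  set K := 3 * q * T with hK
  have K0 : 0 < K := by positivity
  set D := 2 * T ^ 2 * (1 / 8 + 2 * q * T ^ 2) with hD
  have D0 : 0 < D := by positivity
  set C₃ := (D + T ^ 2) / K * (Real.exp (K * T) - 1) with hC₃
  have C₃0 : 0 ≤ C₃ := mul_nonneg (by positivity) (by
    linarith [Real.add_one_le_exp (K * T), mul_pos K0 hT])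
  set C₁ := (C₃ + 2 * T * (K * C₃ + D)) / c with hC₁
  have C₁0 : 0 ≤ C₁ := by positivity
  refine ⟨C₁ + C₃, fun e A₁ A₃ B₁ B₃ h heT => ?_⟩
  have e0 := h.e_pos
  set f : ℝ → ℝ := fun t => (√(taubNUTEta m t))⁻¹ with hf
  have f0 : ∀ t ∈ Ioc 0 T, 0 ≤ f t := fun t _ => by positivity
  have fT : ∀ t ∈ Ioc 0 T, f t ≤ T := fun t ht =>
    (inv_sqrt_taubNUTEta_le hm ht.1).trans ht.2
  have A₁T : ∀ t ∈ Ioc 0 T, A₁ t ≤ 5 / 4 * T := fun t ht =>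
    (h.A₁_le heT ht).trans (by linarith [ht.2])
  have A₃T : ∀ t ∈ Ioc 0 T, A₃ t ≤ 5 / 4 * T := fun t ht =>
    (h.A₃_lt_A₁ ht.1).le.trans (A₁T t ht)
  -- The `1/8` is the offset of the initial value of `κ` from `q`; the other term bounds its growth.
  have kq : ∀ t ∈ Ioc 0 T, |(A₁ t - A₃ t) / (A₁ t * A₃ t ^ 2) - q| ≤
      e * (1 / 8 + 2 * q * T ^ 2) := by
    intro t ht
    have h1 := h.le_kappa ht.1
    have h2 := h.kappa_le heT ht
    have h3 : (q - e / 8) * (1 + 2 * (e * T ^ 2)) ≤ q * (1 + 2 * (e * T ^ 2)) :=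
      mul_le_mul_of_nonneg_right (by linarith) (by positivity)
    have h4 : 0 ≤ e * (2 * q * T ^ 2) := by positivity
    rw [abs_le]
    constructor <;> linarith
  have xy : ∀ t ∈ Ioc 0 T, |A₃ t / A₁ t - (1 - q * f t ^ 2)| ≤ K * |A₃ t - f t| + D * e := by
    intro t ht
    have h3 := h.A₃_pos t ht.1
    have e1 : A₃ t / A₁ t - (1 - q * f t ^ 2) = q * (f t + A₃ t) * (f t - A₃ t) -
        ((A₁ t - A₃ t) / (A₁ t * A₃ t ^ 2) - q) * A₃ t ^ 2 := by
      linear_combination h.kappa_mul_sq ht.1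
    rw [e1]
    refine (abs_sub _ _).trans (add_le_add ?_ ?_)
    · rw [abs_mul, abs_of_nonneg (mul_nonneg q0.le (by linarith [f0 t ht])), abs_sub_comm]
      refine mul_le_mul_of_nonneg_right ?_ (abs_nonneg _)
      have := mul_le_mul_of_nonneg_left
        (show f t + A₃ t ≤ 3 * T by linarith [fT t ht, A₃T t ht]) q0.le
      linarith
    · rw [abs_mul, abs_of_nonneg (sq_nonneg (A₃ t))]
      have h5 : A₃ t ^ 2 ≤ 2 * T ^ 2 := by nlinarith [A₃T t ht]
      refine (mul_le_mul (kq t ht) h5 (sq_nonneg _) (by positivity)).trans_eq ?_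
      rw [hD]
      ring
  have b3 : ∀ t ∈ Ioc 0 T, |A₃ t - f t| ≤ C₃ * e := by
    intro t ht
    have hlim : Tendsto (fun s => A₃ s - f s) (𝓝[>] 0) (𝓝 0) := by
      simpa using h.lim_A₃.sub (tendsto_inv_sqrt_taubNUTEta hm)
    have hg := abs_le_of_gronwall (f := fun s => A₃ s - f s) (T := T)
      (e := (D + T ^ 2) * e) K0
      (fun s hs => (h.ode_A₃ s hs.1).sub (hasDerivAt_inv_sqrt_taubNUTEta hm hs.1))
      (fun s hs => ?_) hlim ht
    · refine hg.trans ?_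
      have h1 : Real.exp (K * t) ≤ Real.exp (K * T) :=
        Real.exp_le_exp.2 (mul_le_mul_of_nonneg_left ht.2 K0.le)
      calc (D + T ^ 2) * e / K * (Real.exp (K * t) - 1)
          ≤ (D + T ^ 2) * e / K * (Real.exp (K * T) - 1) :=
            mul_le_mul_of_nonneg_left (by linarith) (by positivity)
        _ = C₃ * e := by rw [hC₃]; ring
    · have h1 := h.A₁_pos s hs.1
      have h3 := h.A₃_pos s hs.1
      have g1 := h.one_le_B₁ heT hs
      -- With `x = A₃/A₁` and `y = 1 - q f²`, both in `[0, 1]`, the main part is `(x² - y²)/2`, so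
      -- it is at most `|x - y|` in absolute value.
      have e1 : A₃ s ^ 2 / 2 * (1 / A₁ s ^ 2 - e / B₁ s ^ 2) - (1 - q * f s ^ 2) ^ 2 / 2 =
          (A₃ s / A₁ s - (1 - q * f s ^ 2)) * ((A₃ s / A₁ s + (1 - q * f s ^ 2)) / 2) -
          e * (A₃ s ^ 2 / (2 * B₁ s ^ 2)) := by
        field_simp
        ring
      have hx1 : A₃ s / A₁ s ≤ 1 := (div_le_one h1).2 (h.A₃_lt_A₁ hs.1).le
      have hx0 : 0 < A₃ s / A₁ s := by positivity
      have hy0 := hc s hs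
      have hy0' : c ≤ 1 - q * f s ^ 2 := hy0
      have hy1 : 1 - q * f s ^ 2 ≤ 1 := by
        have : 0 ≤ q * f s ^ 2 := by positivity
        linarith
      have hB : A₃ s ^ 2 / (2 * B₁ s ^ 2) ≤ T ^ 2 := by
        rw [div_le_iff₀ (by positivity)]
        have hB1 : 1 ≤ B₁ s ^ 2 := one_le_pow₀ g1
        have h5 : A₃ s ^ 2 ≤ 2 * T ^ 2 := by nlinarith [A₃T s hs]
        nlinarith [sq_nonneg T]
      have hb1 : |(A₃ s / A₁ s - (1 - q * f s ^ 2)) * ((A₃ s / A₁ s + (1 - q * f s ^ 2)) / 2)| ≤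
          K * |A₃ s - f s| + D * e := by
        rw [abs_mul]
        refine le_trans ?_ (xy s hs)
        refine mul_le_of_le_one_right (abs_nonneg _) ?_
        rw [abs_of_nonneg (by linarith)]
        linarith
      have hb2 : |e * (A₃ s ^ 2 / (2 * B₁ s ^ 2))| ≤ T ^ 2 * e := by
        rw [abs_of_nonneg (by positivity), mul_comm]
        exact mul_le_mul_of_nonneg_right hB e0.le
      change |A₃ s ^ 2 / 2 * (1 / A₁ s ^ 2 - e / B₁ s ^ 2) - (1 - q * f s ^ 2) ^ 2 / 2| ≤ _
      rw [e1]
      refine (abs_sub _ _).trans ?_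
      linarith
  intro t ht
  have hb3 := b3 t ht
  have hp : 0 ≤ C₁ * e := by positivity
  have hp3 : 0 ≤ C₃ * e := by positivity
  refine ⟨?_, by linarith⟩
  set f₁ := √(taubNUTEta m t) * (taubNUTEta m t - q)⁻¹ with hf₁
  have hy : f₁ * (1 - q * f t ^ 2) = f t := taubNUT_mul_one_sub hm ht.1
  have hcy : c ≤ 1 - q * f t ^ 2 := hc t ht
  have h1 := h.A₁_pos t ht.1
  have hx : A₁ t * (A₃ t / A₁ t) = A₃ t := by field_simp
  -- Subtracting `f₁ y = f` from `A₁ x = A₃`; dividing by `y ≥ c` then controls `A₁ - f₁`.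
  have e2 : (A₁ t - f₁) * (1 - q * f t ^ 2) =
      (A₃ t - f t) - A₁ t * (A₃ t / A₁ t - (1 - q * f t ^ 2)) := by
    linear_combination -hy + hx
  have h2 : |A₁ t - f₁| * c ≤ C₃ * e + 2 * T * ((K * C₃ + D) * e) := by
    calc |A₁ t - f₁| * c ≤ |A₁ t - f₁| * |1 - q * f t ^ 2| :=
          mul_le_mul_of_nonneg_left (hcy.trans (le_abs_self _)) (abs_nonneg _)
      _ = |(A₃ t - f t) - A₁ t * (A₃ t / A₁ t - (1 - q * f t ^ 2))| := by rw [← abs_mul, e2]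
      _ ≤ |A₃ t - f t| + A₁ t * |A₃ t / A₁ t - (1 - q * f t ^ 2)| := by
          refine (abs_sub _ _).trans ?_
          rw [abs_mul, abs_of_pos h1]
      _ ≤ C₃ * e + 2 * T * ((K * C₃ + D) * e) := by
          refine add_le_add hb3 (mul_le_mul (by linarith [A₁T t ht]) ((xy t ht).trans ?_)
            (abs_nonneg _) (by positivity))
          have := mul_le_mul_of_nonneg_left hb3 K0.le
          linarith
  have h3 : |A₁ t - f₁| ≤ C₁ * e := by
    rw [hC₁, div_mul_eq_mul_div, le_div_iff₀ c0]
    linarith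
  linarith

/-! ### Expansions at the singular orbit -/

section Expansion

variable {p c d : ℝ} {f : ℝ → ℝ}

theorem tendsto_of_expansion
    (hO : (fun t => f t - (p + c * t ^ 2 + d * t ^ 4)) =O[𝓝[>] 0] fun t => t ^ 6) :
    Tendsto (fun t => ((f t - p) / t ^ 2 - c) / t ^ 2) (𝓝[>] 0) (𝓝 d) := by
  have h1 : (fun t : ℝ => t ^ 6) =o[𝓝[>] 0] fun t => t ^ 4 :=
    (isLittleO_pow_pow (𝕜 := ℝ) (by norm_num)).mono nhdsWithin_le_nhds
  have h2 := (hO.trans_isLittleO h1).tendsto_div_nhds_zero.add_const d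
  rw [zero_add] at h2
  refine h2.congr' ?_
  filter_upwards [self_mem_nhdsWithin] with t ht
  have : t ≠ 0 := ne_of_gt ht
  field_simp
  ring

/-- A big-O bound alone cannot be differentiated; smoothness up to `0` makes the remainder's
derivative `o(t³)`. -/
theorem tendsto_deriv_of_expansion (hf : ContDiffOn ℝ ∞ f (Ici 0))
    (hO : (fun t => f t - (p + c * t ^ 2 + d * t ^ 4)) =O[𝓝[>] 0] fun t => t ^ 6) :
    Tendsto (fun t => (deriv f t / t - 2 * c) / t ^ 2) (𝓝[>] 0) (𝓝 (4 * d)) := by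
  have h1 : (fun t : ℝ => t ^ 6) =o[𝓝[>] 0] fun t => t ^ (3 + 1) :=
    (isLittleO_pow_pow (𝕜 := ℝ) (by norm_num)).mono nhdsWithin_le_nhds
  have h2 := (deriv_isLittleO_of_isLittleO (hf.sub (by fun_prop)) 3
    (hO.trans_isLittleO h1)).tendsto_div_nhds_zero.add_const (4 * d)
  rw [zero_add] at h2
  refine h2.congr' ?_
  filter_upwards [self_mem_nhdsWithin] with t ht
  have ht' : (0 : ℝ) < t := ht
  have hd : HasDerivAt f (deriv f t) t :=
    ((hf.contDiffAt (Ici_mem_nhds ht')).differentiableAt (by simp)).hasDerivAt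
  have hp : HasDerivAt (fun t : ℝ => p + c * t ^ 2 + d * t ^ 4)
      (c * (2 * t) + d * (4 * t ^ 3)) t := by
    refine (((((hasDerivAt_id t).pow 2).const_mul c).const_add p).add
      (((hasDerivAt_id t).pow 4).const_mul d)).congr_deriv ?_
    simp
  have hfp : HasDerivAt (fun t => f t - (p + c * t ^ 2 + d * t ^ 4)) _ t := hd.sub hp
  rw [hfp.deriv]
  field_simp
  ring

end Expansion

theorem tendsto_add_sq_mul {g : ℝ → ℝ} {c d : ℝ} (hg : Tendsto g (𝓝[>] 0) (𝓝 d)) :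
    Tendsto (fun t => c + t ^ 2 * g t) (𝓝[>] 0) (𝓝 c) := by
  have h : Tendsto (fun t : ℝ => t ^ 2) (𝓝[>] 0) (𝓝 0) :=
    tendsto_nhdsWithin_of_tendsto_nhds (by simpa using (continuous_pow 2).tendsto (0 : ℝ))
  simpa using (h.mul hg).const_add c

/-- The square factor lets `b - p` come out of `√F`, and the other two factors are those in `A₁` and
`B₁`. -/
theorem hitchinF_neg (p a b : ℝ) :
    hitchinF p (-p) a b = (b - p) ^ 2 * ((2 * a - b - p) * (2 * a + b + p)) := by
  rw [hitchinF]
  ring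

theorem deriv_hitchinF_left (p a b : ℝ) :
    deriv (fun u => hitchinF p (-p) u b) a = 8 * a * (b - p) ^ 2 := by
  have h : HasDerivAt (fun u : ℝ => 4 * u ^ 2 * (b - p) * (b + -p) - (b ^ 2 + p * -p) ^ 2)
      (4 * (2 * a) * (b - p) * (b + -p)) a := by
    simpa using ((((hasDerivAt_id a).pow 2).const_mul 4).mul_const (b - p)).mul_const (b + -p)
      |>.sub_const ((b ^ 2 + p * -p) ^ 2)
  rw [show (fun u => hitchinF p (-p) u b) = fun u : ℝ =>
    4 * u ^ 2 * (b - p) * (b + -p) - (b ^ 2 + p * -p) ^ 2 from rfl, h.deriv]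
  ring

theorem deriv_hitchinF_right (p a b : ℝ) :
    deriv (fun u => hitchinF p (-p) a u) b =
      2 * (b - p) * ((2 * a - b - p) * (2 * a + b + p)) - 2 * (b - p) ^ 2 * (b + p) := by
  have h : HasDerivAt (fun u : ℝ => 4 * a ^ 2 * (u - p) * (u + -p) - (u ^ 2 + p * -p) ^ 2)
      ((4 * a ^ 2 * 1) * (b + -p) + (4 * a ^ 2 * (b - p)) * 1 -
        2 * (b ^ 2 + p * -p) ^ 1 * (2 * b)) b := by
    have h1 := (((hasDerivAt_id b).sub_const p).const_mul (4 * a ^ 2)).mul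
      ((hasDerivAt_id b).add_const (-p))
    have h2 := (((hasDerivAt_id b).pow 2).add_const (p * -p)).pow 2
    refine (h1.sub h2).congr_deriv ?_
    simp
  rw [show (fun u => hitchinF p (-p) a u) = fun u : ℝ =>
    4 * a ^ 2 * (u - p) * (u + -p) - (u ^ 2 + p * -p) ^ 2 from rfl, h.deriv]
  ring

/-! ### Leading behaviour of `a`, `b` and their derivatives at `t = 0`. -/

namespace IsB7Solution

variable {r A B : ℝ} {a b : ℝ → ℝ}

theorem hasDerivAt_a (h : IsB7Solution r A B a b) {t : ℝ} (ht : 0 < t) :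
    HasDerivAt a (deriv a t) t :=
  (h.flow.ode_y₁ t ht).differentiableAt.hasDerivAt

theorem hasDerivAt_b (h : IsB7Solution r A B a b) {t : ℝ} (ht : 0 < t) :
    HasDerivAt b (deriv b t) t :=
  (h.flow.ode_y₂ t ht).differentiableAt.hasDerivAt

theorem tendsto_a₄ (h : IsB7Solution r A B a b) :
    Tendsto (fun t => ((a t - r ^ 3) / t ^ 2 - 1 / 4 * r) / t ^ 2) (𝓝[>] 0) (𝓝 A) :=
  tendsto_of_expansion h.expansion_a

theorem tendsto_b₄ (h : IsB7Solution r A B a b) :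
    Tendsto (fun t => ((b t - r ^ 3) / t ^ 2 - 1 / 4 * r) / t ^ 2) (𝓝[>] 0) (𝓝 B) :=
  tendsto_of_expansion h.expansion_b

theorem tendsto_deriv_a₄ (h : IsB7Solution r A B a b) :
    Tendsto (fun t => (deriv a t / t - 2 * (1 / 4 * r)) / t ^ 2) (𝓝[>] 0) (𝓝 (4 * A)) :=
  tendsto_deriv_of_expansion h.smooth_a h.expansion_a

theorem tendsto_deriv_b₄ (h : IsB7Solution r A B a b) :
    Tendsto (fun t => (deriv b t / t - 2 * (1 / 4 * r)) / t ^ 2) (𝓝[>] 0) (𝓝 (4 * B)) :=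
  tendsto_deriv_of_expansion h.smooth_b h.expansion_b

theorem tendsto_deriv_a_div (h : IsB7Solution r A B a b) :
    Tendsto (fun t => deriv a t / t) (𝓝[>] 0) (𝓝 (r / 2)) := by
  have h1 := tendsto_add_sq_mul (c := r / 2) h.tendsto_deriv_a₄
  refine h1.congr' ?_
  filter_upwards [self_mem_nhdsWithin] with t ht
  have : t ≠ 0 := ne_of_gt ht
  field_simp
  ring

theorem tendsto_deriv_b_div (h : IsB7Solution r A B a b) :
    Tendsto (fun t => deriv b t / t) (𝓝[>] 0) (𝓝 (r / 2)) := by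
  have h1 := tendsto_add_sq_mul (c := r / 2) h.tendsto_deriv_b₄
  refine h1.congr' ?_
  filter_upwards [self_mem_nhdsWithin] with t ht
  have : t ≠ 0 := ne_of_gt ht
  field_simp
  ring

theorem tendsto_a_div (h : IsB7Solution r A B a b) :
    Tendsto (fun t => (a t - r ^ 3) / t ^ 2) (𝓝[>] 0) (𝓝 (r / 4)) := by
  have h1 := tendsto_add_sq_mul (c := r / 4) h.tendsto_a₄
  refine h1.congr' ?_
  filter_upwards [self_mem_nhdsWithin] with t ht
  have : t ≠ 0 := ne_of_gt ht
  field_simp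
  ring

theorem tendsto_b_div (h : IsB7Solution r A B a b) :
    Tendsto (fun t => (b t - r ^ 3) / t ^ 2) (𝓝[>] 0) (𝓝 (r / 4)) := by
  have h1 := tendsto_add_sq_mul (c := r / 4) h.tendsto_b₄
  refine h1.congr' ?_
  filter_upwards [self_mem_nhdsWithin] with t ht
  have : t ≠ 0 := ne_of_gt ht
  field_simp
  ring

theorem tendsto_a (h : IsB7Solution r A B a b) : Tendsto a (𝓝[>] 0) (𝓝 (r ^ 3)) := by
  have h1 := tendsto_add_sq_mul (c := r ^ 3) h.tendsto_a_div
  refine h1.congr' ?_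
  filter_upwards [self_mem_nhdsWithin] with t ht
  have : t ≠ 0 := ne_of_gt ht
  field_simp
  ring

theorem tendsto_b (h : IsB7Solution r A B a b) : Tendsto b (𝓝[>] 0) (𝓝 (r ^ 3)) := by
  have h1 := tendsto_add_sq_mul (c := r ^ 3) h.tendsto_b_div
  refine h1.congr' ?_
  filter_upwards [self_mem_nhdsWithin] with t ht
  have : t ≠ 0 := ne_of_gt ht
  field_simp
  ring

theorem tendsto_deriv_a (h : IsB7Solution r A B a b) : Tendsto (deriv a) (𝓝[>] 0) (𝓝 0) := by
  have h1 := h.tendsto_deriv_a_div.mul (tendsto_nhdsWithin_of_tendsto_nhds tendsto_id)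
  rw [mul_zero] at h1
  refine h1.congr' ?_
  filter_upwards [self_mem_nhdsWithin] with t ht
  have : t ≠ 0 := ne_of_gt ht
  simp only [id]
  field_simp

theorem tendsto_deriv_b (h : IsB7Solution r A B a b) : Tendsto (deriv b) (𝓝[>] 0) (𝓝 0) := by
  have h1 := h.tendsto_deriv_b_div.mul (tendsto_nhdsWithin_of_tendsto_nhds tendsto_id)
  rw [mul_zero] at h1
  refine h1.congr' ?_
  filter_upwards [self_mem_nhdsWithin] with t ht
  have : t ≠ 0 := ne_of_gt ht
  simp only [id]
  field_simp

/-! ### Positivity along the flow -/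

theorem deriv_a_ne_zero (h : IsB7Solution r A B a b) {t : ℝ} (ht : 0 < t) : deriv a t ≠ 0 := by
  intro h0
  simpa [h0] using h.flow.x_pos t ht

theorem deriv_a_pos (h : IsB7Solution r A B a b) {t : ℝ} (ht : 0 < t) : 0 < deriv a t := by
  by_contra! hle
  have hev := h.tendsto_deriv_a_div.eventually (lt_mem_nhds (half_pos h.r₀_pos))
  obtain ⟨s, hs1, hs2⟩ := (hev.and self_mem_nhdsWithin).exists
  have hs : 0 < deriv a s := (div_pos_iff_of_pos_right hs2).1 hs1
  have hc : ContinuousOn (deriv a) (Ioi 0) :=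
    (h.smooth_a.mono Ioi_subset_Ici_self).continuousOn_deriv_of_isOpen isOpen_Ioi (by simp)
  obtain ⟨z, hz, hz0⟩ := isPreconnected_Ioi.intermediate_value (mem_Ioi.2 ht) hs2 hc
    ⟨hle, hs.le⟩
  exact h.deriv_a_ne_zero hz hz0

theorem deriv_b_pos (h : IsB7Solution r A B a b) {t : ℝ} (ht : 0 < t) : 0 < deriv b t := by
  have hx := h.flow.x_pos t ht
  have h1 : deriv a t * deriv b t ≠ 0 := fun h0 => by simp [h0] at hx
  rw [(h.flow.ode_y₂ t ht).deriv]
  exact div_pos (by positivity) (Real.sqrt_pos.2 hx)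

theorem b_gt (h : IsB7Solution r A B a b) {t : ℝ} (ht : 0 < t) : 0 < b t - r ^ 3 := by
  have h1 : r ^ 3 ≤ b t := le_of_tendsto_of_hasDerivAt_nonneg (T := t)
    (fun _ hs => h.hasDerivAt_b hs) (fun _ hs => (h.deriv_b_pos hs.1).le) h.tendsto_b ⟨ht, le_rfl⟩
  have h2 := h.flow.F_pos t ht
  rw [hitchinF_neg] at h2
  refine lt_of_le_of_ne (sub_nonneg.2 h1) fun h0 => ?_
  simp [← h0] at h2

theorem a_ge (h : IsB7Solution r A B a b) {t : ℝ} (ht : 0 < t) : r ^ 3 ≤ a t :=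
  le_of_tendsto_of_hasDerivAt_nonneg (T := t)
    (fun _ hs => h.hasDerivAt_a hs) (fun _ hs => (h.deriv_a_pos hs.1).le) h.tendsto_a ⟨ht, le_rfl⟩

theorem add_pos' (h : IsB7Solution r A B a b) {t : ℝ} (ht : 0 < t) :
    0 < 2 * a t + b t + r ^ 3 := by
  have := pow_pos h.r₀_pos 3
  linarith [h.a_ge ht, h.b_gt ht]

theorem sub_pos' (h : IsB7Solution r A B a b) {t : ℝ} (ht : 0 < t) :
    0 < 2 * a t - b t - r ^ 3 := by
  have h2 := h.flow.F_pos t ht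
  rw [hitchinF_neg] at h2
  exact pos_of_mul_pos_left (pos_of_mul_pos_right h2 (sq_nonneg _)) (h.add_pos' ht).le

theorem sqrt_F (h : IsB7Solution r A B a b) {t : ℝ} (ht : 0 < t) :
    √(hitchinF (r ^ 3) (-r ^ 3) (a t) (b t)) =
      (b t - r ^ 3) * √((2 * a t - b t - r ^ 3) * (2 * a t + b t + r ^ 3)) := by
  rw [hitchinF_neg, Real.sqrt_mul (sq_nonneg _), Real.sqrt_sq (h.b_gt ht).le]

/-! ### The reduced second order system -/

theorem hasDerivAt_mul (h : IsB7Solution r A B a b) {t : ℝ} (ht : 0 < t) :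
    HasDerivAt (fun t => deriv a t * deriv b t)
      (2 * a t * (b t - r ^ 3) /
        √((2 * a t - b t - r ^ 3) * (2 * a t + b t + r ^ 3))) t := by
  refine (h.flow.ode_x₁ t ht).congr_deriv ?_
  have h1 := h.b_gt ht
  have h2 := Real.sqrt_pos.2 (mul_pos (h.sub_pos' ht) (h.add_pos' ht))
  rw [h.sqrt_F ht, deriv_hitchinF_left]
  field_simp
  ring

theorem hasDerivAt_deriv_a (h : IsB7Solution r A B a b) {t : ℝ} (ht : 0 < t) :
    HasDerivAt (deriv a)
      ((√((2 * a t - b t - r ^ 3) * (2 * a t + b t + r ^ 3)) - (b t - r ^ 3) * (b t + r ^ 3) /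
        √((2 * a t - b t - r ^ 3) * (2 * a t + b t + r ^ 3))) / (2 * deriv a t)) t := by
  have h0 := h.deriv_a_pos ht
  have h1 := h.b_gt ht
  have hus := mul_pos (h.sub_pos' ht) (h.add_pos' ht)
  have h2 := Real.sqrt_pos.2 hus
  have hd := (h.flow.ode_x₂ t ht).sqrt (by positivity)
  have hd' : HasDerivAt (deriv a) _ t := hd.congr_of_eventuallyEq (by
    filter_upwards [Ioi_mem_nhds ht] with s hs
    exact (Real.sqrt_sq (h.deriv_a_pos hs).le).symm)
  refine hd'.congr_deriv ?_
  rw [Real.sqrt_sq h0.le, h.sqrt_F ht, deriv_hitchinF_right]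
  have hs := (Real.sq_sqrt hus.le).symm
  set G := √((2 * a t - b t - r ^ 3) * (2 * a t + b t + r ^ 3))
  rw [hs]
  field_simp

theorem hasDerivAt_sub (h : IsB7Solution r A B a b) {t : ℝ} (ht : 0 < t) :
    HasDerivAt (fun t => 2 * a t - b t - r ^ 3) (2 * deriv a t - deriv b t) t :=
  (((h.hasDerivAt_a ht).const_mul 2).sub (h.hasDerivAt_b ht)).sub_const _

theorem hasDerivAt_add (h : IsB7Solution r A B a b) {t : ℝ} (ht : 0 < t) :
    HasDerivAt (fun t => 2 * a t + b t + r ^ 3) (2 * deriv a t + deriv b t) t :=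
  (((h.hasDerivAt_a ht).const_mul 2).add (h.hasDerivAt_b ht)).add_const _

/-- Conservation of the Hamiltonian. -/
theorem hamiltonian (h : IsB7Solution r A B a b) {t : ℝ} (ht : 0 < t) :
    2 * deriv a t ^ 2 * deriv b t =
      (b t - r ^ 3) * √((2 * a t - b t - r ^ 3) * (2 * a t + b t + r ^ 3)) := by
  -- The difference has zero derivative along the flow and tends to `0` at the singular orbit.
  have key : 2 * deriv a t * (deriv a t * deriv b t) -
      (b t - r ^ 3) * √((2 * a t - b t - r ^ 3) * (2 * a t + b t + r ^ 3)) = 0 := by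
    refine eq_of_tendsto_of_hasDerivAt_zero
      (f := fun t => 2 * deriv a t * (deriv a t * deriv b t) -
        (b t - r ^ 3) * √((2 * a t - b t - r ^ 3) * (2 * a t + b t + r ^ 3)))
      (fun s hs => ?_) ?_ ht
    · have h0 := h.deriv_a_pos hs
      have hus := mul_pos (h.sub_pos' hs) (h.add_pos' hs)
      have h2 := Real.sqrt_pos.2 hus
      refine ((((h.hasDerivAt_deriv_a hs).const_mul 2).mul (h.hasDerivAt_mul hs)).sub
        (((h.hasDerivAt_b hs).sub_const (r ^ 3)).mul
          (((h.hasDerivAt_sub hs).mul (h.hasDerivAt_add hs)).sqrt hus.ne'))).congr_deriv ?_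
      simp only [Pi.mul_apply]
      set G := √((2 * a s - b s - r ^ 3) * (2 * a s + b s + r ^ 3))
      field_simp
      ring
    · have hl := ((h.tendsto_deriv_a.const_mul 2).mul (h.tendsto_deriv_a.mul h.tendsto_deriv_b)).sub
        ((h.tendsto_b.sub_const (r ^ 3)).mul
          ((((h.tendsto_a.const_mul 2).sub h.tendsto_b).sub_const (r ^ 3)).mul
            (((h.tendsto_a.const_mul 2).add h.tendsto_b).add_const (r ^ 3))).sqrt)
      simpa using hl
  linarith

/-! ### The metric coefficients along the flow -/

/-- The flow variables expressed through the metric coefficients. -/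
theorem metric_relations (h : IsB7Solution r A B a b) {t : ℝ} (ht : 0 < t) :
    ∃ A₁ A₃ B₁ B₃ : ℝ, 0 < A₁ ∧ 0 < A₃ ∧ 0 < B₁ ∧ 0 < B₃ ∧
      metricA (r ^ 3) a b 0 t = A₁ ∧ metricA (r ^ 3) a b 2 t = A₃ ∧
      metricB (r ^ 3) a b 0 t = B₁ ∧ metricB (r ^ 3) a b 2 t = B₃ ∧
      deriv a t = A₁ * B₁ / 2 ∧ deriv b t = A₃ * B₃ / 2 ∧ b t - r ^ 3 = A₁ * A₃ * B₁ / 2 ∧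
      2 * a t - b t - r ^ 3 = A₁ ^ 2 * B₃ / 2 ∧ 2 * a t + b t + r ^ 3 = B₁ ^ 2 * B₃ / 2 := by
  have hP := h.deriv_a_pos ht
  have hQ := h.deriv_b_pos ht
  have hβ := h.b_gt ht
  have hu := h.sub_pos' ht
  have hs := h.add_pos' ht
  have hH := h.hamiltonian ht
  have hG := Real.sq_sqrt (mul_pos hu hs).le
  have hG0 := Real.sqrt_pos.2 (mul_pos hu hs)
  have e1 : metricA (r ^ 3) a b 0 t =
      √((b t - r ^ 3) * (2 * a t - b t - r ^ 3) / (deriv a t * deriv b t)) := rfl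
  have e2 : metricB (r ^ 3) a b 0 t =
      √((b t - r ^ 3) * (2 * a t + b t + r ^ 3) / (deriv a t * deriv b t)) := rfl
  have e3 : metricA (r ^ 3) a b 2 t = (b t - r ^ 3) / deriv a t := rfl
  have e4 : metricB (r ^ 3) a b 2 t = 2 * deriv a t * deriv b t / (b t - r ^ 3) := rfl
  rw [e1, e2, e3, e4]
  generalize deriv a t = P at *
  generalize deriv b t = Q at *
  generalize b t - r ^ 3 = β at *
  generalize 2 * a t - b t - r ^ 3 = u at *
  generalize 2 * a t + b t + r ^ 3 = s at *
  generalize √(u * s) = G at *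
  have q1 : 0 < β * u / (P * Q) := by positivity
  have q2 : 0 < β * s / (P * Q) := by positivity
  have a1 := Real.sq_sqrt q1.le
  have a2 := Real.sq_sqrt q2.le
  -- The only relation that needs the Hamiltonian constraint; the others are definitions or
  -- consequences of it.
  have a3 : √(β * u / (P * Q)) * √(β * s / (P * Q)) = 2 * P := by
    rw [← Real.sqrt_mul q1.le, Real.sqrt_eq_iff_mul_self_eq (by positivity) (by positivity)]
    field_simp
    have : (2 * P ^ 2 * Q) ^ 2 = (β * G) ^ 2 := by rw [hH]
    linear_combination -this - β ^ 2 * hG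
  refine ⟨_, _, _, _, Real.sqrt_pos.2 q1, (by positivity : 0 < β / P), Real.sqrt_pos.2 q2,
    (by positivity : 0 < 2 * P * Q / β), rfl, rfl, rfl, rfl, ?_, ?_, ?_, ?_, ?_⟩
  · rw [a3]; ring
  · field_simp
  · rw [show ∀ x y z : ℝ, x * y * z / 2 = (x * z) * y / 2 by intros; ring, a3]
    field_simp
  · rw [a1]; field_simp
  · rw [a2]; field_simp

theorem metric_pos (h : IsB7Solution r A B a b) {t : ℝ} (ht : 0 < t) :
    0 < metricA (r ^ 3) a b 0 t ∧ 0 < metricA (r ^ 3) a b 2 t ∧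
      0 < metricB (r ^ 3) a b 0 t ∧ 0 < metricB (r ^ 3) a b 2 t := by
  obtain ⟨A₁, A₃, B₁, B₃, p1, p2, p3, p4, rfl, rfl, rfl, rfl, -⟩ := h.metric_relations ht
  exact ⟨p1, p2, p3, p4⟩

theorem sqrt_eq (h : IsB7Solution r A B a b) {t : ℝ} (ht : 0 < t) :
    √((2 * a t - b t - r ^ 3) * (2 * a t + b t + r ^ 3)) =
      metricA (r ^ 3) a b 0 t * metricB (r ^ 3) a b 0 t * metricB (r ^ 3) a b 2 t / 2 := by
  obtain ⟨A₁, A₃, B₁, B₃, p1, p2, p3, p4, e1, e2, e3, e4, e5, e6, e7, e8, e9⟩ :=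
    h.metric_relations ht
  rw [e8, e9, e1, e3, e4, Real.sqrt_eq_iff_mul_self_eq (by positivity) (by positivity)]
  ring

theorem hasDerivAt_A₃ (h : IsB7Solution r A B a b) {t : ℝ} (ht : 0 < t) :
    HasDerivAt (metricA (r ^ 3) a b 2)
      (metricA (r ^ 3) a b 2 t ^ 2 / 2 *
        (1 / metricA (r ^ 3) a b 0 t ^ 2 - 1 / metricB (r ^ 3) a b 0 t ^ 2)) t := by
  have hd : HasDerivAt (metricA (r ^ 3) a b 2) _ t :=
    ((h.hasDerivAt_b ht).sub_const (r ^ 3)).div (h.hasDerivAt_deriv_a ht) (h.deriv_a_ne_zero ht)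
  refine hd.congr_deriv ?_
  rw [h.sqrt_eq ht]
  obtain ⟨A₁, A₃, B₁, B₃, p1, p2, p3, p4, e1, e2, e3, e4, e5, e6, e7, e8, e9⟩ :=
    h.metric_relations ht
  have hbp : b t + r ^ 3 = (B₁ ^ 2 * B₃ / 2 - A₁ ^ 2 * B₃ / 2) / 2 := by linarith
  rw [e1, e2, e3, e4, e5, e6, hbp, e7]
  field_simp
  ring

theorem hasDerivAt_B₃ (h : IsB7Solution r A B a b) {t : ℝ} (ht : 0 < t) :
    HasDerivAt (metricB (r ^ 3) a b 2)
      ((metricB (r ^ 3) a b 0 t ^ 2 + metricA (r ^ 3) a b 0 t ^ 2 -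
        metricB (r ^ 3) a b 2 t ^ 2) /
        (metricA (r ^ 3) a b 0 t * metricB (r ^ 3) a b 0 t)) t := by
  have hd : HasDerivAt (fun t => 2 * (deriv a t * deriv b t) / (b t - r ^ 3)) _ t :=
    ((h.hasDerivAt_mul ht).const_mul 2).div ((h.hasDerivAt_b ht).sub_const (r ^ 3))
      (h.b_gt ht).ne'
  have hf : metricB (r ^ 3) a b 2 = fun t => 2 * (deriv a t * deriv b t) / (b t - r ^ 3) := by
    funext t
    rw [← mul_assoc]
    rfl
  rw [← hf] at hd
  refine hd.congr_deriv ?_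
  rw [h.sqrt_eq ht]
  obtain ⟨A₁, A₃, B₁, B₃, p1, p2, p3, p4, e1, e2, e3, e4, e5, e6, e7, e8, e9⟩ :=
    h.metric_relations ht
  have ha : a t = (B₁ ^ 2 * B₃ / 2 + A₁ ^ 2 * B₃ / 2) / 4 := by linarith
  rw [e1, e3, e4, e5, e6, e7, ha]
  field_simp
  ring

theorem hasDerivAt_A₁ (h : IsB7Solution r A B a b) {t : ℝ} (ht : 0 < t) :
    HasDerivAt (metricA (r ^ 3) a b 0)
      ((metricB (r ^ 3) a b 0 t ^ 2 - metricA (r ^ 3) a b 0 t ^ 2 +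
        metricB (r ^ 3) a b 2 t ^ 2) /
        (2 * metricB (r ^ 3) a b 0 t * metricB (r ^ 3) a b 2 t) -
        metricA (r ^ 3) a b 2 t / (2 * metricA (r ^ 3) a b 0 t)) t := by
  have hP := h.deriv_a_pos ht
  have hQ := h.deriv_b_pos ht
  have hβ := h.b_gt ht
  have hu := h.sub_pos' ht
  have hd : HasDerivAt (metricA (r ^ 3) a b 0) _ t :=
    ((((h.hasDerivAt_b ht).sub_const (r ^ 3)).mul (h.hasDerivAt_sub ht)).div
      (h.hasDerivAt_mul ht) (by positivity)).sqrt
        (by simp only [Pi.mul_apply, Pi.div_apply]; positivity)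
  refine hd.congr_deriv ?_
  have hf : √((b t - r ^ 3) * (2 * a t - b t - r ^ 3) / (deriv a t * deriv b t)) =
      metricA (r ^ 3) a b 0 t := rfl
  simp only [Pi.mul_apply, Pi.div_apply]
  rw [h.sqrt_eq ht, hf]
  obtain ⟨A₁, A₃, B₁, B₃, p1, p2, p3, p4, e1, e2, e3, e4, e5, e6, e7, e8, e9⟩ :=
    h.metric_relations ht
  have ha : a t = (B₁ ^ 2 * B₃ / 2 + A₁ ^ 2 * B₃ / 2) / 4 := by linarith
  rw [e8, e1, e2, e3, e4, e5, e6, e7, ha]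
  field_simp
  ring

theorem hasDerivAt_B₁ (h : IsB7Solution r A B a b) {t : ℝ} (ht : 0 < t) :
    HasDerivAt (metricB (r ^ 3) a b 0)
      ((metricA (r ^ 3) a b 0 t ^ 2 - metricB (r ^ 3) a b 0 t ^ 2 +
        metricB (r ^ 3) a b 2 t ^ 2) /
        (2 * metricA (r ^ 3) a b 0 t * metricB (r ^ 3) a b 2 t) +
        metricA (r ^ 3) a b 2 t / (2 * metricB (r ^ 3) a b 0 t)) t := by
  have hP := h.deriv_a_pos ht
  have hQ := h.deriv_b_pos ht
  have hβ := h.b_gt ht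
  have hs := h.add_pos' ht
  have hd : HasDerivAt (metricB (r ^ 3) a b 0) _ t :=
    ((((h.hasDerivAt_b ht).sub_const (r ^ 3)).mul (h.hasDerivAt_add ht)).div
      (h.hasDerivAt_mul ht) (by positivity)).sqrt
        (by simp only [Pi.mul_apply, Pi.div_apply]; positivity)
  refine hd.congr_deriv ?_
  have hf : √((b t - r ^ 3) * (2 * a t + b t + r ^ 3) / (deriv a t * deriv b t)) =
      metricB (r ^ 3) a b 0 t := rfl
  simp only [Pi.mul_apply, Pi.div_apply]
  rw [h.sqrt_eq ht, hf]
  obtain ⟨A₁, A₃, B₁, B₃, p1, p2, p3, p4, e1, e2, e3, e4, e5, e6, e7, e8, e9⟩ :=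
    h.metric_relations ht
  have ha : a t = (B₁ ^ 2 * B₃ / 2 + A₁ ^ 2 * B₃ / 2) / 4 := by linarith
  rw [e9, e1, e2, e3, e4, e5, e6, e7, ha]
  field_simp
  ring

/-! ### Behaviour of the metric coefficients at the singular orbit -/

theorem tendsto_sub_div (h : IsB7Solution r A B a b) :
    Tendsto (fun t => (2 * a t - b t - r ^ 3) / t ^ 2) (𝓝[>] 0) (𝓝 (r / 4)) := by
  have h1 := (h.tendsto_a_div.const_mul 2).sub h.tendsto_b_div
  rw [show 2 * (r / 4) - r / 4 = r / 4 by ring] at h1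
  refine h1.congr fun t => ?_
  ring

theorem tendsto_A₃ (h : IsB7Solution r A B a b) :
    Tendsto (metricA (r ^ 3) a b 2) (𝓝[>] 0) (𝓝 0) := by
  have h1 := (h.tendsto_b_div.div h.tendsto_deriv_a_div (by linarith [h.r₀_pos])).mul
    (tendsto_nhdsWithin_of_tendsto_nhds tendsto_id)
  rw [mul_zero] at h1
  refine h1.congr' ?_
  filter_upwards [self_mem_nhdsWithin] with t ht
  have h0 : t ≠ 0 := ne_of_gt ht
  have hP := h.deriv_a_ne_zero ht
  change (b t - r ^ 3) / t ^ 2 / (deriv a t / t) * t = (b t - r ^ 3) / deriv a t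
  field_simp

theorem tendsto_B₃ (h : IsB7Solution r A B a b) :
    Tendsto (metricB (r ^ 3) a b 2) (𝓝[>] 0) (𝓝 (2 * r)) := by
  have hr := h.r₀_pos
  have h1 := ((h.tendsto_deriv_a_div.mul h.tendsto_deriv_b_div).const_mul 2).div
    h.tendsto_b_div (by linarith)
  rw [show 2 * (r / 2 * (r / 2)) / (r / 4) = 2 * r by field_simp; norm_num] at h1
  refine h1.congr' ?_
  filter_upwards [self_mem_nhdsWithin] with t ht
  have h0 : t ≠ 0 := ne_of_gt ht
  have hP := (h.b_gt ht).ne'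
  change 2 * (deriv a t / t * (deriv b t / t)) / ((b t - r ^ 3) / t ^ 2) =
    2 * deriv a t * deriv b t / (b t - r ^ 3)
  field_simp

theorem tendsto_B₁ (h : IsB7Solution r A B a b) :
    Tendsto (metricB (r ^ 3) a b 0) (𝓝[>] 0) (𝓝 (2 * r)) := by
  have hr := h.r₀_pos
  have h1 := ((h.tendsto_b_div.mul
    (((h.tendsto_a.const_mul 2).add h.tendsto_b).add_const (r ^ 3))).div
    (h.tendsto_deriv_a_div.mul h.tendsto_deriv_b_div) (by positivity)).sqrt
  rw [show r / 4 * (2 * r ^ 3 + r ^ 3 + r ^ 3) / (r / 2 * (r / 2)) = (2 * r) ^ 2 by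
    field_simp; ring, Real.sqrt_sq (by positivity)] at h1
  refine h1.congr' ?_
  filter_upwards [self_mem_nhdsWithin] with t ht
  have h0 : t ≠ 0 := ne_of_gt ht
  have hP := h.deriv_a_ne_zero ht
  have hQ := (h.deriv_b_pos ht).ne'
  change √((b t - r ^ 3) / t ^ 2 * (2 * a t + b t + r ^ 3) / (deriv a t / t * (deriv b t / t))) =
    √((b t - r ^ 3) * (2 * a t + b t + r ^ 3) / (deriv a t * deriv b t))
  congr 1
  field_simp

theorem tendsto_A₁ (h : IsB7Solution r A B a b) :
    Tendsto (metricA (r ^ 3) a b 0) (𝓝[>] 0) (𝓝 0) := by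
  have hr := h.r₀_pos
  have h1 := (h.tendsto_deriv_a.const_mul 2).div h.tendsto_B₁ (by positivity)
  rw [mul_zero, zero_div] at h1
  refine h1.congr' ?_
  filter_upwards [self_mem_nhdsWithin] with t ht
  obtain ⟨A₁, A₃, B₁, B₃, p1, p2, p3, p4, e1, e2, e3, e4, e5, -⟩ := h.metric_relations ht
  change 2 * deriv a t / metricB (r ^ 3) a b 0 t = _
  rw [e1, e3, e5]
  field_simp

theorem tendsto_ratio (h : IsB7Solution r A B a b) :
    Tendsto (fun t => metricA (r ^ 3) a b 2 t / metricA (r ^ 3) a b 0 t) (𝓝[>] 0) (𝓝 1) := by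
  have hr := h.r₀_pos
  have h1 := (h.tendsto_b_div.div (h.tendsto_deriv_a_div.mul h.tendsto_deriv_a_div)
    (by positivity)).mul (h.tendsto_B₁.div_const 2)
  rw [show r / 4 / (r / 2 * (r / 2)) * (2 * r / 2) = 1 by field_simp; norm_num] at h1
  refine h1.congr' ?_
  filter_upwards [self_mem_nhdsWithin] with t ht
  have h0 : t ≠ 0 := ne_of_gt ht
  obtain ⟨A₁, A₃, B₁, B₃, p1, p2, p3, p4, e1, e2, e3, e4, e5, e6, e7, -⟩ := h.metric_relations ht
  change (b t - r ^ 3) / t ^ 2 / (deriv a t / t * (deriv a t / t)) *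
    (metricB (r ^ 3) a b 0 t / 2) = _
  rw [e1, e2, e3, e5, e7]
  field_simp

/-- Multiplying by `1 + A₃/A₁` removes the square root. With `u = 2a - b - p` and `β = b - p`, the
quotient becomes `a'(a' u - β b') / (u β² (1 + A₃/A₁))`. In `a' u - β b'` the `t³` terms cancel and
the `t⁵` coefficient is `2r(A - B)`, so the fourth-order terms of `a` and `b` fix the limit. -/
theorem tendsto_kappa (h : IsB7Solution r A B a b) :
    Tendsto (fun t => (metricA (r ^ 3) a b 0 t - metricA (r ^ 3) a b 2 t) /
      (metricA (r ^ 3) a b 0 t * metricA (r ^ 3) a b 2 t ^ 2)) (𝓝[>] 0)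
      (𝓝 (32 * (A - B) / r)) := by
  have hr := h.r₀_pos
  have hu := (h.tendsto_a₄.const_mul 2).sub h.tendsto_b₄
  have hm := ((hu.const_mul (r / 2)).add (h.tendsto_deriv_a₄.const_mul (r / 4))).sub
    ((h.tendsto_deriv_b₄.const_mul (r / 4)).add (h.tendsto_b₄.const_mul (r / 2)))
  have hM := hm.add (tendsto_add_sq_mul (c := 0)
    ((h.tendsto_deriv_a₄.mul hu).sub (h.tendsto_b₄.mul h.tendsto_deriv_b₄)))
  have h1 := (h.tendsto_deriv_a_div.mul hM).div ((h.tendsto_sub_div.mul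
    (h.tendsto_b_div.pow 2)).mul (h.tendsto_ratio.const_add 1)) (by positivity)
  have hv : r / 2 * (r / 2 * (2 * A - B) + r / 4 * (4 * A) - (r / 4 * (4 * B) + r / 2 * B) + 0) /
      (r / 4 * (r / 4) ^ 2 * (1 + 1)) = 32 * (A - B) / r := by
    field_simp
    ring
  rw [hv] at h1
  refine h1.congr' ?_
  filter_upwards [self_mem_nhdsWithin] with t ht
  have h0 : t ≠ 0 := ne_of_gt ht
  have hnum : r / 2 * (2 * (((a t - r ^ 3) / t ^ 2 - 1 / 4 * r) / t ^ 2) -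
        ((b t - r ^ 3) / t ^ 2 - 1 / 4 * r) / t ^ 2) +
      r / 4 * ((deriv a t / t - 2 * (1 / 4 * r)) / t ^ 2) -
      (r / 4 * ((deriv b t / t - 2 * (1 / 4 * r)) / t ^ 2) +
        r / 2 * (((b t - r ^ 3) / t ^ 2 - 1 / 4 * r) / t ^ 2)) +
      (0 + t ^ 2 * ((deriv a t / t - 2 * (1 / 4 * r)) / t ^ 2 *
          (2 * (((a t - r ^ 3) / t ^ 2 - 1 / 4 * r) / t ^ 2) -
            ((b t - r ^ 3) / t ^ 2 - 1 / 4 * r) / t ^ 2) -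
        ((b t - r ^ 3) / t ^ 2 - 1 / 4 * r) / t ^ 2 *
          ((deriv b t / t - 2 * (1 / 4 * r)) / t ^ 2))) =
      (deriv a t * (2 * a t - b t - r ^ 3) - (b t - r ^ 3) * deriv b t) / t ^ 5 := by
    field_simp
    ring
  simp only [Pi.div_apply]
  rw [hnum]
  obtain ⟨A₁, A₃, B₁, B₃, p1, p2, p3, p4, e1, e2, e3, e4, e5, e6, e7, e8, -⟩ :=
    h.metric_relations ht
  rw [e1, e2, e5, e6, e7, e8]
  field_simp
  ring

/-! ### Rescaling -/

theorem isScaledFlow (h : IsB7Solution r A B a b) :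
    IsScaledFlow (r ^ 2) (32 * r ^ 3 * (A - B))
      (rescaleA r (metricA (r ^ 3) a b 0)) (rescaleA r (metricA (r ^ 3) a b 2))
      (rescaleB r (metricB (r ^ 3) a b 0)) (rescaleB r (metricB (r ^ 3) a b 2)) := by
  have hr := h.r₀_pos
  have hA : ∀ {f : ℝ → ℝ} {f' t : ℝ}, HasDerivAt f f' (r ^ 2 * t) →
      HasDerivAt (rescaleA r f) f' t := by
    intro f f' t hf
    have hg := (hf.comp t ((hasDerivAt_id t).const_mul (r ^ 2))).const_mul (r ^ 2)⁻¹
    refine hg.congr_deriv ?_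
    field_simp
  -- Time and `A` both scale by `r²` but `B` only by `r`; the mismatch produces the factors `e =
  -- r²`.
  have hB : ∀ {f : ℝ → ℝ} {f' t : ℝ}, HasDerivAt f f' (r ^ 2 * t) →
      HasDerivAt (rescaleB r f) (r * f') t := by
    intro f f' t hf
    have hg := (hf.comp t ((hasDerivAt_id t).const_mul (r ^ 2))).const_mul r⁻¹
    refine hg.congr_deriv ?_
    field_simp
  have hpos : ∀ {t : ℝ}, 0 < t → 0 < r ^ 2 * t := fun ht => by positivity
  have hlim : Tendsto (fun t : ℝ => r ^ 2 * t) (𝓝[>] 0) (𝓝[>] 0) := by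
    refine tendsto_nhdsWithin_of_tendsto_nhds_of_eventually_within _ ?_ ?_
    · have : Tendsto (fun t : ℝ => r ^ 2 * t) (𝓝 0) (𝓝 (r ^ 2 * 0)) := tendsto_id.const_mul _
      rw [mul_zero] at this
      exact this.mono_left nhdsWithin_le_nhds
    · filter_upwards [self_mem_nhdsWithin] with t ht
      exact hpos ht
  have sA : ∀ (f : ℝ → ℝ) (t : ℝ), f (r ^ 2 * t) = r ^ 2 * rescaleA r f t := by
    intro f t
    rw [rescaleA]
    field_simp
  have sB : ∀ (f : ℝ → ℝ) (t : ℝ), f (r ^ 2 * t) = r * rescaleB r f t := by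
    intro f t
    rw [rescaleB]
    field_simp
  have pA₁ : ∀ t, 0 < t → 0 < rescaleA r (metricA (r ^ 3) a b 0) t := fun t ht =>
    mul_pos (by positivity) (h.metric_pos (hpos ht)).1
  have pA₃ : ∀ t, 0 < t → 0 < rescaleA r (metricA (r ^ 3) a b 2) t := fun t ht =>
    mul_pos (by positivity) (h.metric_pos (hpos ht)).2.1
  have pB₁ : ∀ t, 0 < t → 0 < rescaleB r (metricB (r ^ 3) a b 0) t := fun t ht =>
    mul_pos (by positivity) (h.metric_pos (hpos ht)).2.2.1
  have pB₃ : ∀ t, 0 < t → 0 < rescaleB r (metricB (r ^ 3) a b 2) t := fun t ht =>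
    mul_pos (by positivity) (h.metric_pos (hpos ht)).2.2.2
  refine ⟨by positivity, mul_pos (by positivity) (sub_pos.2 h.bbar_lt_abar), pA₁, pA₃, pB₁, pB₃,
    fun t ht => (hA (h.hasDerivAt_A₁ (hpos ht))).congr_deriv ?_,
    fun t ht => (hA (h.hasDerivAt_A₃ (hpos ht))).congr_deriv ?_,
    fun t ht => (hB (h.hasDerivAt_B₁ (hpos ht))).congr_deriv ?_,
    fun t ht => (hB (h.hasDerivAt_B₃ (hpos ht))).congr_deriv ?_, ?_, ?_, ?_, ?_, ?_⟩
  iterate 4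
    have x1 := pA₁ t ht
    have x2 := pA₃ t ht
    have x3 := pB₁ t ht
    have x4 := pB₃ t ht
    simp only [sA (metricA (r ^ 3) a b _), sB (metricB (r ^ 3) a b _)]
    field_simp
  · have := (h.tendsto_A₁.comp hlim).const_mul (r ^ 2)⁻¹
    rwa [mul_zero] at this
  · have := (h.tendsto_A₃.comp hlim).const_mul (r ^ 2)⁻¹
    rwa [mul_zero] at this
  · have := (h.tendsto_B₁.comp hlim).const_mul r⁻¹
    rwa [show r⁻¹ * (2 * r) = 2 by field_simp] at this
  · have := (h.tendsto_B₃.comp hlim).const_mul r⁻¹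
    rwa [show r⁻¹ * (2 * r) = 2 by field_simp] at this
  · have h1 := (h.tendsto_kappa.comp hlim).const_mul (r ^ 4)
    rw [show r ^ 4 * (32 * (A - B) / r) = 32 * r ^ 3 * (A - B) by field_simp] at h1
    refine h1.congr' ?_
    filter_upwards [self_mem_nhdsWithin] with t ht
    have x1 := pA₁ t ht
    have x2 := pA₃ t ht
    simp only [Function.comp, sA (metricA (r ^ 3) a b _)]
    field_simp

end IsB7Solution
end B7

/-! ### Uniform convergence to Taub-NUT. -/

theorem mainTheorem7 (m : ℝ) (hm : 0 < m) {ι : Type*} (l : Filter ι)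
    (r₀ abar bbar : ι → ℝ) (a b : ι → ℝ → ℝ)
    (hB7 : ∀ᶠ n in l, B7.IsB7Solution (r₀ n) (abar n) (bbar n) (a n) (b n))
    (hmass : ∀ᶠ n in l, m ^ 2 = (24 * r₀ n ^ 3 * (2 * abar n - bbar n))⁻¹)
    (hr₀ : Tendsto r₀ l (𝓝 0)) (i : Fin 3) (T : ℝ) :
    TendstoUniformlyOn
      (fun n => B7.rescaleB (r₀ n) (B7.metricB (r₀ n ^ 3) (a n) (b n) i))
      (fun _ => 2) l (Ioc 0 T) ∧
    TendstoUniformlyOn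
      (fun n => B7.rescaleA (r₀ n) (B7.metricA (r₀ n ^ 3) (a n) (b n) i))
      (B7.taubNUT m i) l (Ioc 0 T) := by
  rcases le_or_gt T 0 with hT | hT
  · rw [Ioc_eq_empty (not_lt.2 hT)]
    exact ⟨tendstoUniformlyOn_empty, tendstoUniformlyOn_empty⟩
  obtain ⟨C, hC⟩ := B7.exists_bound_taubNUT hm hT
  have hflow : ∀ᶠ n in l, B7.IsScaledFlow (r₀ n ^ 2) (1 / m ^ 2 - r₀ n ^ 2 / 8)
      (B7.rescaleA (r₀ n) (B7.metricA (r₀ n ^ 3) (a n) (b n) 0))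
      (B7.rescaleA (r₀ n) (B7.metricA (r₀ n ^ 3) (a n) (b n) 2))
      (B7.rescaleB (r₀ n) (B7.metricB (r₀ n ^ 3) (a n) (b n) 0))
      (B7.rescaleB (r₀ n) (B7.metricB (r₀ n ^ 3) (a n) (b n) 2)) := by
    filter_upwards [hB7, hmass] with n h hmn
    have h1 : 1 / m ^ 2 = 24 * r₀ n ^ 3 * (2 * abar n - bbar n) := by
      rw [hmn, one_div, inv_inv]
    have h2 := h.isScaledFlow
    -- Here `32(ā - b̄) = 24(2ā - b̄) - 8(2ā + b̄)`, and the constraint gives `8 r₀³ (2ā + b̄) = r₀²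
    -- / 8`.
    rwa [show 32 * r₀ n ^ 3 * (abar n - bbar n) = 1 / m ^ 2 - r₀ n ^ 2 / 8 by
      rw [h1]
      linear_combination (-(r₀ n ^ 2) / 8) * h.constraint] at h2
  have hsq : Tendsto (fun n => r₀ n ^ 2) l (𝓝 0) := by simpa using hr₀.pow 2
  have hsmall : ∀ᶠ n in l, r₀ n ^ 2 * T ^ 2 ≤ 1 := by
    have : Tendsto (fun n => r₀ n ^ 2 * T ^ 2) l (𝓝 0) := by simpa using hsq.mul_const (T ^ 2)
    exact this.eventually_le_const one_pos
  have unif : ∀ (F : ι → ℝ → ℝ) (f : ℝ → ℝ) (K : ℝ),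
      (∀ᶠ n in l, ∀ t ∈ Ioc 0 T, |F n t - f t| ≤ K * r₀ n ^ 2) →
      TendstoUniformlyOn F f l (Ioc 0 T) := by
    intro F f K h
    rw [Metric.tendstoUniformlyOn_iff]
    intro d hd
    have : Tendsto (fun n => K * r₀ n ^ 2) l (𝓝 0) := by simpa using hsq.const_mul K
    filter_upwards [h, this.eventually_lt_const hd] with n hn hn' t ht
    rw [dist_comm, Real.dist_eq]
    exact (hn t ht).trans_lt hn'
  have uB₁ := unif (fun n => B7.rescaleB (r₀ n) (B7.metricB (r₀ n ^ 3) (a n) (b n) 0))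
    (fun _ => 2) (5 / 4 * T ^ 2) (by
      filter_upwards [hflow, hsmall] with n h hs t ht
      exact (h.abs_B₁_sub_two_le hs ht).trans_eq (by ring))
  have uB₃ := unif (fun n => B7.rescaleB (r₀ n) (B7.metricB (r₀ n ^ 3) (a n) (b n) 2))
    (fun _ => 2) (3 * T ^ 2) (by
      filter_upwards [hflow, hsmall] with n h hs t ht
      exact (h.abs_B₃_sub_two_le hs ht).trans_eq (by ring))
  have uA₁ := unif (fun n => B7.rescaleA (r₀ n) (B7.metricA (r₀ n ^ 3) (a n) (b n) 0))
    (B7.taubNUT m 0) C (by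
      filter_upwards [hflow, hsmall] with n h hs t ht
      exact (hC _ _ _ _ _ h hs t ht).1)
  have uA₃ := unif (fun n => B7.rescaleA (r₀ n) (B7.metricA (r₀ n ^ 3) (a n) (b n) 2))
    (B7.taubNUT m 2) C (by
      filter_upwards [hflow, hsmall] with n h hs t ht
      exact (hC _ _ _ _ _ h hs t ht).2)
  fin_cases i
  · exact ⟨uB₁, uA₁⟩
  · exact ⟨uB₁, uA₁⟩
  · exact ⟨uB₃, uA₃⟩
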